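/- \textbf{Setting.} Let $\Omega$ be a finite set, $P$ an ergodic (irreducible and aperiodic) transition matrix on $\Omega$ with stationary distribution $\mu$, and let $z_1,z_2,\dots$ be a time-homogeneous Markov chain with transition matrix $P$ and arbitrary initial distribution. Put $d_{\mathrm{mix}}(t)=\sup_{z\in\Omega}\sup_{A\subseteq\Omega}|P^t(z,A)-\mu(A)|$ and $\tau_{\mathrm{mix}}=\min\{t\ge 1: d_{\mathrm{mix}}(t)\le 1/4\}$. Let $f(\cdot;z):\mathbb R^d\to\mathbb R$ be differentiable for each $z\in\Omega$ and let $F(w)=\mathbb E_{z\sim\mu}[f(w;z)]$. With constants $M,G>0$ and $L\ge 0$, assume that (i) $\|\nabla f(w;z)\|\le G$ for all $w\in\mathbb R^d$, $z\in\Omega$; (ii) $F$ is $L$-smooth: it is differentiable and $\|\nabla F(x)-\nabla F(y)\|\le L\|x-y\|$ for all $x,y\in\mathbb R^d$; (iii) $|F(w)|\le M$ for all $w\in\mathbb R^d$. \textbf{Algorithm (MAG with $\alpha=1$, unconstrained).} Let $T\ge 1$ and $w_1\in\mathbb R^d$. Let $J_1,J_2,\dots$ be i.i.d. with $\mathbb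 P(J_t=j)=2^{-j}$ for $j\ge1$, independent of the chain. Iteration $t$ reads the next $N_t$ samples $z_t^{(1)},\dots,z_t^{(N_t)}$ of the chain, where $N_t=2^{J_t}$ if $2^{J_t}\le T$; if $2^{J_t}>T$, then $N_t=r(J_t)$ for an arbitrary fixed function $r:\mathbb N\to\{1,2,\dots\}$ (for instance $r(j)=2^j$ or $r(j)=1$). With $g_t^{j}=2^{-j}\sum_{i=1}^{2^j}\nabla f(w_t;z_t^{(i)})$, set \[ g_t=g_t^0+\begin{cases}2^{J_t}\bigl(g_t^{J_t}-g_t^{J_t-1}\bigr), & 2^{J_t}\le T,\\ 0,&\text{otherwise,}\end{cases} \qquad w_{t+1}=w_t-\eta_t g_t,\quad \eta_t=\Bigl(\sum_{k=1}^t\|g_k\|^2\Bigr)^{-1/2}, \] where $w_{t+1}=w_t$ if $g_1=\dots=g_t=0$. \textbf{Theorem.} There are universal constants $C>0$ and $k\in\mathbb N$, depending on none of the data above, such that in every such setting the random variable $\frac1T\sum_{t=1}^T\|\nabla F(w_t)\|^2$ is integrable and \[ \mathbb E\Bigl[\frac1T\sum_{t=1}^T\|\nabla F(w_t)\|^2\Bigr]\le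 C\,(1+\log T)^k\,(M+L+G)\,G\,\sqrt{\frac{\tau_{\mathrm{mix}}}{T}} . \] -/

import Mathlib

open MeasureTheory ProbabilityTheory

noncomputable section

namespace MAG

/-! ### Finite Markov chains and mixing times -/

section Chain

variable {S : Type*} [Fintype S] [DecidableEq S]

/-- A stochastic matrix is ergodic if it is irreducible and aperiodic: for every state `x`, the
greatest common divisor of the possible return times to `x` is one. -/
structure IsErgodic (P : Matrix S S ℝ) : Prop where
  stochastic : P ∈ Matrix.rowStochastic ℝ S
  irreducible : P.IsIrreducible
  aperiodic : ∀ x : S, Nat.setGcd {t : ℕ | 1 ≤ t ∧ 0 < (P ^ t) x x} = 1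

/-- `μ` is a stationary distribution of the transition matrix `P`. -/
structure IsStationary (P : Matrix S S ℝ) (μ : S → ℝ) : Prop where
  mem_simplex : μ ∈ stdSimplex ℝ S
  vecMul_eq : Matrix.vecMul μ P = μ

/-- Total variation distance `sup_A |p(A) - q(A)|` of two distributions on a finite set. -/
def tvDist (p q : S → ℝ) : ℝ :=
  ⨆ A : Finset S, |∑ z ∈ A, p z - ∑ z ∈ A, q z|

/-- Distance from stationarity `sup_z TV (P^t(z, ·), μ)`. -/
def dmix (P : Matrix S S ℝ) (μ : S → ℝ) (t : ℕ) : ℝ :=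
  ⨆ z : S, tvDist ((P ^ t) z) μ

/-- `τ_mix(ε)`: the least positive integer `t` with `dmix t ≤ ε`. -/
def mixingTimeAt (P : Matrix S S ℝ) (μ : S → ℝ) (ε : ℝ) : ℕ :=
  sInf {t : ℕ | 1 ≤ t ∧ dmix P μ t ≤ ε}

/-- The mixing time `τ_mix = τ_mix(1/4)`. -/
def mixingTime (P : Matrix S S ℝ) (μ : S → ℝ) : ℕ :=
  mixingTimeAt P μ (1 / 4)

/-- `Z 0, Z 1, …` is a time-homogeneous Markov chain with transition matrix `P` (and arbitrary
initial distribution): the conditional law of `Z (n + 1)` given that `Z 0, …, Z n` is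
`x 0, …, x n` is `P (x n) ·`. -/
structure IsMarkovChain {Ω : Type*} [MeasurableSpace Ω] (ν : Measure Ω) [MeasurableSpace S]
    (P : Matrix S S ℝ) (Z : ℕ → Ω → S) : Prop where
  measurable : ∀ n, Measurable (Z n)
  markov : ∀ (n : ℕ) (x : ℕ → S),
    ν.real {ω | ∀ i ≤ n + 1, Z i ω = x i} =
      ν.real {ω | ∀ i ≤ n, Z i ω = x i} * P (x n) (x (n + 1))

/-- The objective `F(w) = E_{z ∼ μ} [f(w; z)]`. -/
def objective {E : Type*} (f : E → S → ℝ) (μ : S → ℝ) (w : E) : ℝ :=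
  ∑ z, μ z * f w z

end Chain

/-- `J 0, J 1, …` are i.i.d. geometric variables on `{1, 2, …}` with success probability `1/2`. -/
structure IsIIDGeomHalf {Ω : Type*} [MeasurableSpace Ω] (ν : Measure Ω) (J : ℕ → Ω → ℕ) :
    Prop where
  measurable : ∀ t, Measurable (J t)
  law : ∀ t j, 1 ≤ j → ν.real {ω | J t ω = j} = (1 / 2 : ℝ) ^ j
  indep : iIndepFun J ν

/-- `F` is `L`-smooth on the whole space. -/
structure IsSmoothWith {E : Type*} [NormedAddCommGroup E] [InnerProductSpace ℝ E]
    [CompleteSpace E] (L : ℝ) (F : E → ℝ) : Prop where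
  differentiable : Differentiable ℝ F
  gradient_lipschitz : ∀ x y, ‖gradient F x - gradient F y‖ ≤ L * ‖x - y‖

/-! ### The algorithm, for a given data path `z` and given levels `j` -/

section Algorithm

variable {S E : Type*} [NormedAddCommGroup E] [InnerProductSpace ℝ E] [CompleteSpace E]

/-- Number of data samples consumed by an iteration with level `j`: the `2 ^ j` samples that enter
the estimator if `2 ^ j ≤ T`, and `r j` samples if the level is truncated (only the first of them
then enters the estimator). -/
def numSamples (T : ℕ) (r : ℕ → ℕ) (j : ℕ) : ℕ :=
  if 2 ^ j ≤ T then 2 ^ j else r j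

/-- Number of samples consumed before iteration `t` (iterations are counted from `0`). -/
def startIndex (T : ℕ) (r : ℕ → ℕ) (j : ℕ → ℕ) (t : ℕ) : ℕ :=
  ∑ k ∈ Finset.range t, numSamples T r (j k)

/-- Average of the `2 ^ m` stochastic gradients at `w` along `z s, …, z (s + 2 ^ m - 1)`. -/
def avgGrad (f : E → S → ℝ) (z : ℕ → S) (s m : ℕ) (w : E) : E :=
  (1 / (2 : ℝ) ^ m) • ∑ i ∈ Finset.range (2 ^ m), gradient (fun v => f v (z (s + i))) w

/-- The truncated multi-level Monte Carlo estimator of level `m ≥ 1` at `w`, computed from the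
samples `z s, z (s + 1), …`. -/
def mlmcGrad (f : E → S → ℝ) (T : ℕ) (z : ℕ → S) (s m : ℕ) (w : E) : E :=
  avgGrad f z s 0 w +
    if 2 ^ m ≤ T then (2 : ℝ) ^ m • (avgGrad f z s m w - avgGrad f z s (m - 1) w) else 0

/-- State of MAG on the whole space after `t` iterations: the current iterate together with the
sum of the squared norms of all estimators used so far. The step is
`α / √(∑_{k ≤ t} ‖g k‖²)`; if all estimators so far vanish, the iterate does not move. -/
def magState (α : ℝ) (f : E → S → ℝ) (T : ℕ) (r : ℕ → ℕ) (w₁ : E) (z : ℕ → S) (j : ℕ → ℕ) :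
    ℕ → E × ℝ
  | 0 => (w₁, 0)
  | t + 1 =>
    let w := (magState α f T r w₁ z j t).1
    let g := mlmcGrad f T z (startIndex T r j t) (j t) w
    let v := (magState α f T r w₁ z j t).2 + ‖g‖ ^ 2
    (w - (α / √v) • g, v)

/-- The iterate at which iteration `t` (counted from `0`) of MAG starts. -/
def magIterate (α : ℝ) (f : E → S → ℝ) (T : ℕ) (r : ℕ → ℕ) (w₁ : E) (z : ℕ → S) (j : ℕ → ℕ)
    (t : ℕ) : E :=
  (magState α f T r w₁ z j t).1

/-- The gradient estimator used in iteration `t` (counted from `0`) of MAG. -/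
def magGrad (α : ℝ) (f : E → S → ℝ) (T : ℕ) (r : ℕ → ℕ) (w₁ : E) (z : ℕ → S) (j : ℕ → ℕ)
    (t : ℕ) : E :=
  mlmcGrad f T z (startIndex T r j t) (j t) (magIterate α f T r w₁ z j t)

theorem magState_snd (α : ℝ) (f : E → S → ℝ) (T : ℕ) (r : ℕ → ℕ) (w₁ : E) (z : ℕ → S)
    (j : ℕ → ℕ) (t : ℕ) :
    (magState α f T r w₁ z j t).2 =
      ∑ k ∈ Finset.range t, ‖magGrad α f T r w₁ z j k‖ ^ 2 := by
  induction t with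
  | zero => simp [magState]
  | succ t ih =>
    rw [Finset.sum_range_succ, ← ih]
    rfl

/-- The AdaGrad-Norm recursion for the iterates. -/
theorem magIterate_succ (α : ℝ) (f : E → S → ℝ) (T : ℕ) (r : ℕ → ℕ) (w₁ : E) (z : ℕ → S)
    (j : ℕ → ℕ) (t : ℕ) :
    magIterate α f T r w₁ z j (t + 1) =
      magIterate α f T r w₁ z j t -
        (α / √(∑ k ∈ Finset.range (t + 1), ‖magGrad α f T r w₁ z j k‖ ^ 2)) •
          magGrad α f T r w₁ z j t := by
  rw [← magState_snd]
  rfl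

end Algorithm

end MAG

end

/-!
The step size of AdaGrad-Norm is the inverse of `√V t`, where `V t` is the sum of the squared
norms of the estimators used up to time `t`. Multiplying the descent inequality of the `L`-smooth
function `F` by `√V t` therefore gives a bound on the unweighted inner product `⟪∇F (w t), g t⟫`,
and summation by parts, with `|F| ≤ M`, yields on every path the regret bound
`∑ ⟪∇F (w t), g t⟫ ≤ (2 M + L) √V` (`IsSmoothWith.sum_inner_le`), where `V` is the sum over all
iterations. It remains to compare `g t` with `∇F (w t)` on average.

Irreducibility and aperiodicity make a power of `P` positive, so the mixing time `τ` is attained,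
and `P ^ τ` halves the sup norm of functions of stationary mean zero. Hence the correlations of
such a function along the chain sum to order `τ` (`sum_norm_markovOp_le`), and by the Markov
property the average of `N` values has mean square of order `τ / N`, from any initial distribution
and even if the function depends on the earlier samples
(`IsMarkovChain.integral_norm_sum_sq_le`). Thus the average of `2 ^ m` stochastic gradients has
mean square error of order `τ G² / 2 ^ m`.

The levels are independent of the chain, so expectations may be computed with the levels frozen,
and the current level is independent of everything before it. With `K = ⌊log₂ T⌋`, the weights
`2 ^ m` of the multi-level estimator make its expectation telescope to that of the average of
`2 ^ K ≥ T / 2` gradients, whose bias is of order `G √(τ / T)`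
(`Setting.integral_norm_gradient_sq_le`). In the second moment level `m` contributes
`2 ^ (-m) 4 ^ m τ G² / 2 ^ m`, which is of order `τ G²` for each of the `K` levels
(`Setting.integral_norm_magGrad_sq_le`). Taking expectations in the regret bound, with
`E √V ≤ √(E V)`, gives the rate.

All functionals of the algorithm that occur depend on finitely many levels and, once these are
given, on finitely many samples (`IsFinitary`), which settles all questions of measurability.
-/

noncomputable section

namespace MAG

/-! ### Convergence of ergodic chains to stationarity -/

section Mixing

variable {S : Type*} [Fintype S]

theorem tvDist_le_sum_abs (p q : S → ℝ) : tvDist p q ≤ ∑ z, |p z - q z| := by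
  refine ciSup_le fun A => ?_
  rw [← Finset.sum_sub_distrib]
  exact (Finset.abs_sum_le_sum_abs _ _).trans
    (Finset.sum_le_univ_sum_of_nonneg fun _ => abs_nonneg _)

theorem sum_abs_le_two_mul_tvDist (p q : S → ℝ) : ∑ z, |p z - q z| ≤ 2 * tvDist p q := by
  have hle : ∀ A : Finset S, |∑ z ∈ A, p z - ∑ z ∈ A, q z| ≤ tvDist p q :=
    fun A => le_ciSup (f := fun A : Finset S => |∑ z ∈ A, p z - ∑ z ∈ A, q z|)
      (Set.finite_range _).bddAbove A
  rw [← Finset.sum_filter_add_sum_filter_not Finset.univ (fun z => q z ≤ p z)]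
  have h1 : ∑ z with q z ≤ p z, |p z - q z| ≤ tvDist p q := by
    refine le_trans (le_of_eq ?_) ((le_abs_self _).trans (hle {z | q z ≤ p z}))
    rw [← Finset.sum_sub_distrib]
    refine Finset.sum_congr rfl fun z hz => abs_of_nonneg ?_
    simpa using hz
  have h2 : ∑ z with ¬ q z ≤ p z, |p z - q z| ≤ tvDist p q := by
    refine le_trans (le_of_eq ?_) ((neg_le_abs _).trans (hle {z | ¬ q z ≤ p z}))
    rw [← Finset.sum_sub_distrib, ← Finset.sum_neg_distrib]
    refine Finset.sum_congr rfl fun z hz => abs_of_neg ?_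
    simpa using hz
  linarith

/-- A matrix with nonnegative entries `≥ δ` and unit row sums contracts the `ℓ¹` norm of row
vectors of total mass zero: subtracting the constant matrix `δ` does not change the product. -/
theorem sum_abs_vecMul_le {Q : Matrix S S ℝ} {δ : ℝ} (hδ : ∀ x y, δ ≤ Q x y)
    (hQ : ∀ x, ∑ y, Q x y = 1) {v : S → ℝ} (hv : ∑ x, v x = 0) :
    ∑ y, |∑ x, v x * Q x y| ≤ (1 - Fintype.card S * δ) * ∑ x, |v x| := by
  calc ∑ y, |∑ x, v x * Q x y| = ∑ y, |∑ x, v x * (Q x y - δ)| := by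
        refine Finset.sum_congr rfl fun y _ => ?_
        simp only [mul_sub, Finset.sum_sub_distrib, ← Finset.sum_mul, hv, zero_mul, sub_zero]
    _ ≤ ∑ y, ∑ x, |v x| * (Q x y - δ) := by
        refine Finset.sum_le_sum fun y _ => (Finset.abs_sum_le_sum_abs _ _).trans_eq ?_
        refine Finset.sum_congr rfl fun x _ => ?_
        rw [abs_mul, abs_of_nonneg (sub_nonneg.2 (hδ x y))]
    _ = (1 - Fintype.card S * δ) * ∑ x, |v x| := by
        rw [Finset.sum_comm, Finset.mul_sum]
        refine Finset.sum_congr rfl fun x _ => ?_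
        rw [← Finset.mul_sum, Finset.sum_sub_distrib, hQ x]
        simp [mul_comm]

variable [DecidableEq S] {P : Matrix S S ℝ} {μ : S → ℝ}

theorem pow_add_apply_pos (hP : ∀ x y, 0 ≤ P x y) {a b : ℕ} {x y z : S}
    (h₁ : 0 < (P ^ a) x y) (h₂ : 0 < (P ^ b) y z) : 0 < (P ^ (a + b)) x z := by
  rw [pow_add, Matrix.mul_apply]
  exact Finset.sum_pos' (fun w _ => mul_nonneg (Matrix.pow_apply_nonneg hP a x w)
    (Matrix.pow_apply_nonneg hP b w z)) ⟨y, Finset.mem_univ y, mul_pos h₁ h₂⟩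

/-- Return times to a fixed state are closed under addition and have gcd one, so all large times
are return times; irreducibility transports this to every pair of states. -/
theorem IsErgodic.exists_pow_pos [Nonempty S] (hP : IsErgodic P) :
    ∃ m, 1 ≤ m ∧ ∀ x y, 0 < (P ^ m) x y := by
  have hnn : ∀ x y, 0 ≤ P x y := fun x y => Matrix.nonneg_of_mem_rowStochastic hP.stochastic
  obtain ⟨o⟩ := ‹Nonempty S›
  obtain ⟨n, hn⟩ := Nat.exists_mem_closure_of_ge {t : ℕ | 1 ≤ t ∧ 0 < (P ^ t) o o}
  have hret : ∀ k, n ≤ k → 0 < (P ^ k) o o := by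
    intro k hk
    have hmem := hn k hk (by rw [hP.aperiodic o]; exact one_dvd _)
    clear hk
    induction hmem using AddSubmonoid.closure_induction with
    | mem x hx => exact hx.2
    | zero => simp
    | add a b _ _ ha hb => exact pow_add_apply_pos hnn ha hb
  choose k hk hkpos using (Matrix.isIrreducible_iff_exists_pow_pos hnn).1 hP.irreducible
  -- `K` bounds the length of a path from any `x` through the return state `o` to any `y`.
  set K := ∑ x, k x o + ∑ y, k o y with hK
  refine ⟨K + n + 1, by omega, fun x y => ?_⟩
  have h1 : k x o ≤ ∑ x, k x o :=
    Finset.single_le_sum (f := fun x => k x o) (fun _ _ => Nat.zero_le _) (Finset.mem_univ x)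
  have h2 : k o y ≤ ∑ y, k o y :=
    Finset.single_le_sum (f := fun y => k o y) (fun _ _ => Nat.zero_le _) (Finset.mem_univ y)
  have h3 := pow_add_apply_pos hnn (pow_add_apply_pos hnn (hkpos x o)
    (hret (K + n + 1 - k x o - k o y) (by omega))) (hkpos o y)
  rwa [show k x o + (K + n + 1 - k x o - k o y) + k o y = K + n + 1 by omega] at h3

theorem pow_row_sum (hP : P ∈ Matrix.rowStochastic ℝ S) (k : ℕ) (x : S) :
    ∑ y, (P ^ k) x y = 1 :=
  Matrix.sum_row_of_mem_rowStochastic (pow_mem hP k) x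

theorem pow_nonneg_apply (hP : P ∈ Matrix.rowStochastic ℝ S) (k : ℕ) (x y : S) :
    0 ≤ (P ^ k) x y :=
  Matrix.nonneg_of_mem_rowStochastic (pow_mem hP k)

theorem IsStationary.vecMul_pow (hμ : IsStationary P μ) (k : ℕ) :
    Matrix.vecMul μ (P ^ k) = μ := by
  induction k with
  | zero => simp
  | succ k ih => rw [pow_succ, ← Matrix.vecMul_vecMul, ih, hμ.vecMul_eq]

theorem IsStationary.sum_mul_pow (hμ : IsStationary P μ) (k : ℕ) (y : S) :
    ∑ x, μ x * (P ^ k) x y = μ y :=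
  congrFun (hμ.vecMul_pow k) y

theorem IsErgodic.exists_dmix_le [Nonempty S] (hP : IsErgodic P) (hμ : IsStationary P μ)
    {ε : ℝ} (hε : 0 < ε) : ∃ t, 1 ≤ t ∧ dmix P μ t ≤ ε := by
  obtain ⟨m, hm, hpos⟩ := hP.exists_pow_pos
  have hsum := fun k x => pow_row_sum hP.stochastic k x
  obtain ⟨⟨a, b⟩, hab⟩ := Finite.exists_min fun q : S × S => (P ^ m) q.1 q.2
  set δ := (P ^ m) a b
  have hδ : ∀ x y, δ ≤ (P ^ m) x y := fun x y => hab (x, y)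
  set c := 1 - Fintype.card S * δ with hc
  have hc0 : 0 ≤ c := by
    have : ∑ _y : S, δ ≤ ∑ y, (P ^ m) a y := Finset.sum_le_sum fun y _ => hδ a y
    rw [hsum] at this
    simp at this
    linarith
  have hc1 : c < 1 := by
    have : 0 < (Fintype.card S : ℝ) * δ :=
      mul_pos (by exact_mod_cast Fintype.card_pos) (hpos a b)
    linarith
  have hμ1 : ∑ x, μ x = 1 := hμ.mem_simplex.2
  have key : ∀ k x, ∑ y, |(P ^ (m * k)) x y - μ y| ≤ c ^ k * 2 := by
    intro k x
    induction k with
    | zero =>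
      calc ∑ y, |(P ^ (m * 0)) x y - μ y| ≤ ∑ y, ((P ^ (m * 0)) x y + μ y) := by
            refine Finset.sum_le_sum fun y _ => (abs_sub _ _).trans_eq ?_
            rw [abs_of_nonneg (pow_nonneg_apply hP.stochastic _ x y),
              abs_of_nonneg (hμ.mem_simplex.1 y)]
        _ = c ^ 0 * 2 := by rw [Finset.sum_add_distrib, hsum, hμ1]; norm_num
    | succ k ih =>
      have h := sum_abs_vecMul_le hδ (hsum m) (v := fun y => (P ^ (m * k)) x y - μ y)
        (by rw [Finset.sum_sub_distrib, hsum, hμ1, sub_self])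
      have heq : ∀ y, ∑ z, ((P ^ (m * k)) x z - μ z) * (P ^ m) z y =
          (P ^ (m * (k + 1))) x y - μ y := by
        intro y
        simp only [sub_mul, Finset.sum_sub_distrib, hμ.sum_mul_pow]
        rw [mul_add, mul_one, pow_add, Matrix.mul_apply]
      simp only [heq] at h
      calc _ ≤ c * ∑ y, |(P ^ (m * k)) x y - μ y| := h
        _ ≤ c * (c ^ k * 2) := mul_le_mul_of_nonneg_left ih hc0
        _ = c ^ (k + 1) * 2 := by ring
  obtain ⟨k, hk⟩ := exists_pow_lt_of_lt_one (half_pos hε) hc1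
  refine ⟨m * (k + 1), Nat.mul_pos hm k.succ_pos, ciSup_le fun x => ?_⟩
  refine (tvDist_le_sum_abs _ _).trans ((key (k + 1) x).trans ?_)
  have : c ^ (k + 1) ≤ c ^ k := pow_le_pow_of_le_one hc0 hc1.le k.le_succ
  linarith

theorem IsErgodic.mixingTime_spec [Nonempty S] (hP : IsErgodic P) (hμ : IsStationary P μ) :
    1 ≤ mixingTime P μ ∧ dmix P μ (mixingTime P μ) ≤ 1 / 4 :=
  Nat.sInf_mem (s := {t : ℕ | 1 ≤ t ∧ dmix P μ t ≤ 1 / 4})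
    (hP.exists_dmix_le hμ (by norm_num))

theorem sum_abs_pow_sub_le (t : ℕ) (x : S) :
    ∑ y, |(P ^ t) x y - μ y| ≤ 2 * dmix P μ t :=
  (sum_abs_le_two_mul_tvDist _ _).trans (mul_le_mul_of_nonneg_left
    (le_ciSup (f := fun z => tvDist ((P ^ t) z) μ) (Set.finite_range _).bddAbove x) zero_le_two)

variable {E : Type*} [NormedAddCommGroup E] [NormedSpace ℝ E]

/-- The Markov operator `(P ^ k h)(x) = ∑ y, P ^ k (x, y) h(y)` on vector-valued functions. -/
def markovOp (P : Matrix S S ℝ) (k : ℕ) (h : S → E) (x : S) : E :=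
  ∑ y, (P ^ k) x y • h y

theorem markovOp_add (k l : ℕ) (h : S → E) (x : S) :
    markovOp P (k + l) h x = markovOp P k (markovOp P l h) x := by
  simp only [markovOp, pow_add, Matrix.mul_apply, Finset.sum_smul, Finset.smul_sum, mul_smul]
  exact Finset.sum_comm

theorem norm_markovOp_le (hP : P ∈ Matrix.rowStochastic ℝ S) (k : ℕ) {h : S → E} {B : ℝ}
    (hB : ∀ y, ‖h y‖ ≤ B) (x : S) : ‖markovOp P k h x‖ ≤ B := by
  calc ‖markovOp P k h x‖ ≤ ∑ y, (P ^ k) x y * B := by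
        refine (norm_sum_le _ _).trans (Finset.sum_le_sum fun y _ => ?_)
        rw [norm_smul, Real.norm_of_nonneg (pow_nonneg_apply hP k x y)]
        exact mul_le_mul_of_nonneg_left (hB y) (pow_nonneg_apply hP k x y)
    _ = B := by rw [← Finset.sum_mul, pow_row_sum hP, one_mul]

theorem IsStationary.sum_smul_markovOp (hμ : IsStationary P μ) (k : ℕ) (h : S → E) :
    ∑ x, μ x • markovOp P k h x = ∑ y, μ y • h y := by
  simp only [markovOp, Finset.smul_sum, smul_smul]
  rw [Finset.sum_comm]
  simp only [← Finset.sum_smul, hμ.sum_mul_pow]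

/-- At time `t` with `dmix t ≤ 1/4` the Markov operator halves the sup norm of functions of
stationary mean zero. -/
theorem norm_markovOp_le_half {t : ℕ} (ht : dmix P μ t ≤ 1 / 4) {h : S → E} {B : ℝ}
    (hB : ∀ y, ‖h y‖ ≤ B) (hB0 : 0 ≤ B) (hmean : ∑ y, μ y • h y = 0) (x : S) :
    ‖markovOp P t h x‖ ≤ B / 2 := by
  have heq : markovOp P t h x = ∑ y, ((P ^ t) x y - μ y) • h y := by
    simp only [sub_smul, Finset.sum_sub_distrib, hmean, sub_zero, markovOp]
  calc ‖markovOp P t h x‖ ≤ ∑ y, |(P ^ t) x y - μ y| * B := by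
        rw [heq]
        refine (norm_sum_le _ _).trans (Finset.sum_le_sum fun y _ => ?_)
        rw [norm_smul, Real.norm_eq_abs]
        exact mul_le_mul_of_nonneg_left (hB y) (abs_nonneg _)
    _ ≤ (2 * (1 / 4)) * B := by
        rw [← Finset.sum_mul]
        exact mul_le_mul_of_nonneg_right ((sum_abs_pow_sub_le t x).trans (by linarith)) hB0
    _ = B / 2 := by ring

/-- The correlations of a function of stationary mean zero are summable, with a total of order
the mixing time. -/
theorem sum_norm_markovOp_le (hP : P ∈ Matrix.rowStochastic ℝ S) (hμ : IsStationary P μ) {t : ℕ}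
    (ht1 : 1 ≤ t) (ht : dmix P μ t ≤ 1 / 4) (N : ℕ) {h : S → E} {B : ℝ}
    (hB : ∀ y, ‖h y‖ ≤ B) (hB0 : 0 ≤ B) (hmean : ∑ y, μ y • h y = 0) (x : S) :
    ∑ k ∈ Finset.range N, ‖markovOp P k h x‖ ≤ 2 * t * B := by
  induction N using Nat.strong_induction_on generalizing h B with
  | _ N ih =>
    have hcrude : ∀ n, ∑ k ∈ Finset.range n, ‖markovOp P k h x‖ ≤ n * B := fun n => by
      simpa using Finset.sum_le_card_nsmul (Finset.range n) _ B
        fun k _ => norm_markovOp_le hP k hB x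
    rcases le_or_gt N t with hN | hN
    · refine (hcrude N).trans (mul_le_mul_of_nonneg_right ?_ hB0)
      have : (N : ℝ) ≤ t := by exact_mod_cast hN
      linarith [(Nat.cast_nonneg t : (0 : ℝ) ≤ t)]
    · obtain ⟨n, rfl⟩ := Nat.exists_eq_add_of_lt hN
      rw [add_assoc, Finset.sum_range_add]
      have h2 := ih (n + 1) (by omega) (norm_markovOp_le_half ht hB hB0 hmean)
        (by linarith) (by rw [hμ.sum_smul_markovOp, hmean])
      simp only [add_comm t, markovOp_add]
      linarith [hcrude t]

end Mixing

/-! ### The Markov property for functionals of finitely many samples -/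

section MarkovProperty

variable {S Ω : Type*} {Z : ℕ → Ω → S}

/-- The infinite path that follows `x 0, …, x n` and then stays at `x n`. -/
def extendPath (n : ℕ) (x : Fin (n + 1) → S) (i : ℕ) : S :=
  x ⟨min i n, by omega⟩

theorem forall_eq_extendPath_iff {n : ℕ} {z : ℕ → S} {x : Fin (n + 1) → S} :
    (∀ i ≤ n, z i = extendPath n x i) ↔ x = fun i : Fin (n + 1) => z i := by
  constructor
  · intro h
    funext i
    rw [h i (Nat.lt_succ_iff.1 i.2)]
    simp only [extendPath]
    congr 1
    ext
    simp [Nat.lt_succ_iff.1 i.2]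
  · rintro rfl i hi
    simp [extendPath, hi]

theorem indicator_eq_sum_paths [Fintype S] {n : ℕ} {ψ : (ℕ → S) → ℝ} (hψ : DependsOn ψ (Set.Iic n))
    (A : Set Ω) (ω : Ω) :
    A.indicator (fun ω => ψ fun i => Z i ω) ω =
      ∑ x : Fin (n + 1) → S, ({ω | ∀ i ≤ n, Z i ω = extendPath n x i} ∩ A).indicator
        (fun _ => ψ (extendPath n x)) ω := by
  rw [Finset.sum_eq_single (fun i : Fin (n + 1) => Z i ω)]
  · have h := (forall_eq_extendPath_iff (n := n) (z := fun i => Z i ω)).2 rfl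
    have hval : ψ (fun i => Z i ω) = ψ (extendPath n fun i : Fin (n + 1) => Z i ω) := hψ h
    by_cases hω : ω ∈ A
    · rw [Set.indicator_of_mem hω, Set.indicator_of_mem, hval]
      exact ⟨h, hω⟩
    · rw [Set.indicator_of_notMem hω, Set.indicator_of_notMem fun h => hω h.2]
  · intro x _ hx
    refine Set.indicator_of_notMem (fun h => hx ?_) _
    exact (forall_eq_extendPath_iff (z := fun i => Z i ω)).1 h.1
  · simp

variable [MeasurableSpace Ω] {ν : Measure Ω} [MeasurableSpace S] [MeasurableSingletonClass S]

theorem measurableSet_path (hZ : ∀ n, Measurable (Z n)) (n : ℕ) (x : ℕ → S) :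
    MeasurableSet {ω | ∀ i ≤ n, Z i ω = x i} := by
  simp only [Set.ofPred_forall]
  exact MeasurableSet.iInter fun i => MeasurableSet.iInter fun _ =>
    hZ i (measurableSet_singleton (x i))

variable [Fintype S] [IsFiniteMeasure ν]

theorem integrable_of_dependsOn (hZ : ∀ n, Measurable (Z n)) {n : ℕ} {ψ : (ℕ → S) → ℝ}
    (hψ : DependsOn ψ (Set.Iic n)) : Integrable (fun ω => ψ fun i => Z i ω) ν := by
  classical
  have h : (fun ω => ψ fun i => Z i ω) = fun ω => ∑ x : Fin (n + 1) → S,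
      ({ω | ∀ i ≤ n, Z i ω = extendPath n x i} ∩ Set.univ).indicator
        (fun _ => ψ (extendPath n x)) ω := by
    funext ω
    rw [← indicator_eq_sum_paths hψ, Set.indicator_univ]
  rw [h]
  exact integrable_finsetSum _ fun x _ => (integrable_const _).indicator
    ((measurableSet_path hZ n _).inter MeasurableSet.univ)

theorem integral_indicator_eq_sum_paths (hZ : ∀ n, Measurable (Z n)) {n : ℕ} {ψ : (ℕ → S) → ℝ}
    (hψ : DependsOn ψ (Set.Iic n)) {A : Set Ω} (hA : MeasurableSet A) :
    ∫ ω, A.indicator (fun ω => ψ fun i => Z i ω) ω ∂ν =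
      ∑ x : Fin (n + 1) → S,
        ν.real ({ω | ∀ i ≤ n, Z i ω = extendPath n x i} ∩ A) * ψ (extendPath n x) := by
  classical
  have hm : ∀ x : Fin (n + 1) → S,
      MeasurableSet ({ω | ∀ i ≤ n, Z i ω = extendPath n x i} ∩ A) :=
    fun x => (measurableSet_path hZ n _).inter hA
  rw [funext (indicator_eq_sum_paths hψ A),
    integral_finsetSum _ fun x _ => (integrable_const _).indicator (hm x)]
  refine Finset.sum_congr rfl fun x _ => ?_
  rw [integral_indicator_const _ (hm x), smul_eq_mul]

variable [DecidableEq S] {P : Matrix S S ℝ}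

/-- Both sides are summed over the values of `Z 0, …, Z n` and of `Z (n + 1)`, which reduces the
claim to the defining property of the chain. -/
theorem IsMarkovChain.integral_one_step (hZ : IsMarkovChain ν P Z) (n : ℕ)
    {φ : (ℕ → S) → S → ℝ} (hφ : ∀ y, DependsOn (fun z => φ z y) (Set.Iic n)) :
    ∫ ω, φ (fun i => Z i ω) (Z (n + 1) ω) ∂ν =
      ∫ ω, ∑ y, P (Z n ω) y * φ (fun i => Z i ω) y ∂ν := by
  have hA : ∀ y, MeasurableSet {ω | Z (n + 1) ω = y} :=
    fun y => hZ.measurable (n + 1) (measurableSet_singleton y)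
  have hdep : ∀ y, DependsOn (fun z : ℕ → S => P (z n) y * φ z y) (Set.Iic n) := by
    intro y z z' h
    simp only [hφ y h, h n (Set.mem_Iic.2 le_rfl)]
  have hleft : (fun ω => φ (fun i => Z i ω) (Z (n + 1) ω)) = fun ω =>
      ∑ y, {ω | Z (n + 1) ω = y}.indicator (fun ω => φ (fun i => Z i ω) y) ω := by
    funext ω
    simp [Set.indicator_apply]
  rw [hleft, integral_finsetSum _ fun y _ =>
      (integrable_of_dependsOn hZ.measurable (hφ y)).indicator (hA y),
    integral_finsetSum _ fun y _ => integrable_of_dependsOn hZ.measurable (hdep y)]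
  refine Finset.sum_congr rfl fun y _ => ?_
  have h2 := integral_indicator_eq_sum_paths (ν := ν) hZ.measurable (hdep y) MeasurableSet.univ
  simp only [Set.indicator_univ, Set.inter_univ] at h2
  rw [integral_indicator_eq_sum_paths hZ.measurable (hφ y) (hA y), h2]
  refine Finset.sum_congr rfl fun x _ => ?_
  have h := hZ.markov n (Function.update (extendPath n x) (n + 1) y)
  have h1 : {ω | ∀ i ≤ n + 1, Z i ω = Function.update (extendPath n x) (n + 1) y i} =
      {ω | ∀ i ≤ n, Z i ω = extendPath n x i} ∩ {ω | Z (n + 1) ω = y} := by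
    ext ω
    simp only [Set.mem_ofPred_eq, Set.mem_inter_iff, Nat.le_succ_iff, or_imp, forall_and,
      forall_eq, Nat.succ_eq_add_one, Function.update_self]
    refine and_congr_left fun _ => forall₂_congr fun i hi => ?_
    rw [Function.update_of_ne (by omega)]
  have h3 : {ω | ∀ i ≤ n, Z i ω = Function.update (extendPath n x) (n + 1) y i} =
      {ω | ∀ i ≤ n, Z i ω = extendPath n x i} := by
    ext ω
    refine forall₂_congr fun i hi => ?_
    rw [Function.update_of_ne (by omega)]
  rw [h1, h3, Function.update_self, Function.update_of_ne (by omega)] at h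
  rw [h, mul_assoc]

/-- The Markov property at lag `k`, for functionals of the first `n + 1` samples. -/
theorem IsMarkovChain.integral_lag (hZ : IsMarkovChain ν P Z) (n k : ℕ)
    {φ : (ℕ → S) → S → ℝ} (hφ : ∀ y, DependsOn (fun z => φ z y) (Set.Iic n)) :
    ∫ ω, φ (fun i => Z i ω) (Z (n + k) ω) ∂ν =
      ∫ ω, markovOp P k (φ fun i => Z i ω) (Z n ω) ∂ν := by
  induction k generalizing φ with
  | zero => simp [markovOp, Matrix.one_apply]
  | succ k ih =>
    rw [← add_assoc, hZ.integral_one_step (n + k) fun y =>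
      (hφ y).mono (Set.Iic_subset_Iic.2 (Nat.le_add_right n k))]
    have h := ih (φ := fun z => markovOp P 1 (φ z)) fun y z z' hz => by
      simp only [markovOp]
      exact Finset.sum_congr rfl fun u _ => by rw [show φ z u = φ z' u from hφ u hz]
    simp only [← markovOp_add] at h
    rw [← h]
    simp [markovOp]

/-! ### Mean-square error of averages along the chain -/

variable {E : Type*} [NormedAddCommGroup E] [InnerProductSpace ℝ E]

theorem norm_sum_sq_le_two_mul_sum_inner (v : ℕ → E) (N : ℕ) :
    ‖∑ i ∈ Finset.range N, v i‖ ^ 2 ≤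
      2 * ∑ i ∈ Finset.range N, ∑ k ∈ Finset.range (N - i), inner ℝ (v i) (v (i + k)) := by
  induction N generalizing v with
  | zero => simp
  | succ N ih =>
    have h := ih fun i => v (i + 1)
    rw [Finset.sum_range_succ' v, Finset.sum_range_succ' (fun i => ∑ k ∈ _, _), norm_add_sq_real]
    simp only [Nat.add_sub_add_right, Nat.sub_zero, zero_add]
    rw [Finset.sum_range_succ' (fun k => inner ℝ (v 0) (v k)), ← inner_sum,
      real_inner_self_eq_norm_sq, real_inner_comm]
    simp only [add_assoc, add_comm 1] at h ⊢
    nlinarith [sq_nonneg ‖v 0‖]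

/-- Along the chain, the sum of `N` values of a bounded function of stationary mean zero has second
moment of order `N τ`, from any initial distribution. The function `H` may depend on the samples
seen before the window. -/
theorem IsMarkovChain.integral_norm_sum_sq_le [IsProbabilityMeasure ν]
    (hP : P ∈ Matrix.rowStochastic ℝ S) {μ : S → ℝ}
    (hμ : IsStationary P μ) {τ : ℕ} (hτ1 : 1 ≤ τ) (hτ : dmix P μ τ ≤ 1 / 4)
    (hZ : IsMarkovChain ν P Z) {s : ℕ} {H : (ℕ → S) → S → E} {B : ℝ}
    (hH : DependsOn H (Set.Iio s)) (hB0 : 0 ≤ B) (hB : ∀ z y, ‖H z y‖ ≤ B)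
    (hmean : ∀ z, ∑ y, μ y • H z y = 0) (N : ℕ) :
    ∫ ω, ‖∑ i ∈ Finset.range N, H (fun i => Z i ω) (Z (s + i) ω)‖ ^ 2 ∂ν ≤
      4 * N * τ * B ^ 2 := by
  have hH' : ∀ {z z' : ℕ → S} {n : ℕ}, s ≤ n → (∀ i ∈ Set.Iic n, z i = z' i) → H z = H z' :=
    fun hn h => hH fun i hi => h i (Set.mem_Iic.2 ((Set.mem_Iio.1 hi).le.trans hn))
  -- The two sides of the Markov property at time `s + i` and lag `k`.
  have hint : ∀ i k, Integrable (fun ω => inner ℝ (H (fun i => Z i ω) (Z (s + i) ω))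
      (H (fun i => Z i ω) (Z (s + (i + k)) ω))) ν := fun i k =>
    integrable_of_dependsOn (n := s + (i + k)) (ψ := fun z => inner ℝ (H z (z (s + i)))
      (H z (z (s + (i + k))))) hZ.measurable fun z z' h => by
        simp only [hH' (by omega) h, h (s + i) (Set.mem_Iic.2 (by omega)),
          h (s + (i + k)) (Set.mem_Iic.2 (by omega))]
  have hint' : ∀ i k, Integrable (fun ω => inner ℝ (H (fun i => Z i ω) (Z (s + i) ω))
      (markovOp P k (H fun i => Z i ω) (Z (s + i) ω))) ν := fun i k =>
    integrable_of_dependsOn (n := s + i) (ψ := fun z => inner ℝ (H z (z (s + i)))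
      (markovOp P k (H z) (z (s + i)))) hZ.measurable fun z z' h => by
        simp only [hH' (by omega) h, h (s + i) (Set.mem_Iic.2 (by omega))]
  have hlag : ∀ i k, ∫ ω, inner ℝ (H (fun i => Z i ω) (Z (s + i) ω))
      (H (fun i => Z i ω) (Z (s + (i + k)) ω)) ∂ν =
      ∫ ω, inner ℝ (H (fun i => Z i ω) (Z (s + i) ω))
        (markovOp P k (H fun i => Z i ω) (Z (s + i) ω)) ∂ν := by
    intro i k
    have h := hZ.integral_lag (s + i) k
      (φ := fun z y => inner ℝ (H z (z (s + i))) (H z y)) fun y z z' h => by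
        simp only [hH' (by omega) h, h (s + i) (Set.mem_Iic.2 (by omega))]
    rw [← add_assoc, h]
    simp only [markovOp, inner_sum, inner_smul_right, smul_eq_mul]
  have hrow : ∀ i, ∑ k ∈ Finset.range (N - i), ∫ ω, inner ℝ (H (fun i => Z i ω) (Z (s + i) ω))
      (H (fun i => Z i ω) (Z (s + (i + k)) ω)) ∂ν ≤ 2 * τ * B ^ 2 := by
    intro i
    simp only [hlag]
    rw [← integral_finsetSum _ fun k _ => hint' i k]
    refine (integral_mono (integrable_finsetSum _ fun k _ => hint' i k)
      (integrable_const (2 * τ * B ^ 2)) fun ω => ?_).trans_eq (by simp)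
    calc ∑ k ∈ Finset.range (N - i), inner ℝ (H (fun i => Z i ω) (Z (s + i) ω))
          (markovOp P k (H fun i => Z i ω) (Z (s + i) ω))
        ≤ ∑ k ∈ Finset.range (N - i), B * ‖markovOp P k (H fun i => Z i ω) (Z (s + i) ω)‖ :=
          Finset.sum_le_sum fun k _ => (real_inner_le_norm _ _).trans
            (mul_le_mul_of_nonneg_right (hB _ _) (norm_nonneg _))
      _ ≤ B * (2 * τ * B) := by
          rw [← Finset.mul_sum]
          exact mul_le_mul_of_nonneg_left
            (sum_norm_markovOp_le hP hμ hτ1 hτ _ (hB _) hB0 (hmean _) _) hB0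
      _ = 2 * τ * B ^ 2 := by ring
  calc ∫ ω, ‖∑ i ∈ Finset.range N, H (fun i => Z i ω) (Z (s + i) ω)‖ ^ 2 ∂ν
      ≤ ∫ ω, 2 * ∑ i ∈ Finset.range N, ∑ k ∈ Finset.range (N - i),
          inner ℝ (H (fun i => Z i ω) (Z (s + i) ω))
            (H (fun i => Z i ω) (Z (s + (i + k)) ω)) ∂ν := by
        refine integral_mono_of_nonneg (ae_of_all _ fun ω => sq_nonneg _)
          ((integrable_finsetSum _ fun i _ =>
            integrable_finsetSum _ fun k _ => hint i k).const_mul 2) (ae_of_all _ fun ω => ?_)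
        exact norm_sum_sq_le_two_mul_sum_inner (fun i => H (fun i => Z i ω) (Z (s + i) ω)) N
    _ = 2 * ∑ i ∈ Finset.range N, ∑ k ∈ Finset.range (N - i),
          ∫ ω, inner ℝ (H (fun i => Z i ω) (Z (s + i) ω))
            (H (fun i => Z i ω) (Z (s + (i + k)) ω)) ∂ν := by
        rw [integral_const_mul, integral_finsetSum _ fun i _ =>
          integrable_finsetSum _ fun k _ => hint i k]
        congr 1
        exact Finset.sum_congr rfl fun i _ => integral_finsetSum _ fun k _ => hint i k
    _ ≤ 2 * ∑ i ∈ Finset.range N, 2 * τ * B ^ 2 := by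
        gcongr with i _
        exact hrow i
    _ = 4 * N * τ * B ^ 2 := by
        rw [Finset.sum_const, Finset.card_range, nsmul_eq_mul]
        ring

end MarkovProperty

/-! ### The AdaGrad-Norm regret bound along a path -/

section AdaGrad

variable {E : Type*} [NormedAddCommGroup E] [InnerProductSpace ℝ E] [CompleteSpace E]

/-- The quadratic upper bound of a smooth function. -/
theorem IsSmoothWith.le_quadratic {L : ℝ} {F : E → ℝ} (hF : IsSmoothWith L F) (x y : E) :
    F y ≤ F x + inner ℝ (gradient F x) (y - x) + L / 2 * ‖y - x‖ ^ 2 := by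
  set v := y - x with hv
  set ψ : ℝ → ℝ := fun s => F (x + s • v) - s * inner ℝ (gradient F x) v - L / 2 * ‖v‖ ^ 2 * s ^ 2
  have hline : ∀ s : ℝ, HasDerivAt (fun s : ℝ => x + s • v) v s := fun s => by
    simpa using ((hasDerivAt_id s).smul_const v).const_add x
  have hψ : ∀ s, HasDerivAt ψ (inner ℝ (gradient F (x + s • v)) v - inner ℝ (gradient F x) v -
      L * ‖v‖ ^ 2 * s) s := fun s => by
    have h1 := ((hF.differentiable (x + s • v)).hasGradientAt.hasFDerivAt).comp_hasDerivAt s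
      (hline s)
    rw [InnerProductSpace.toDual_apply_apply] at h1
    have h2 := (hasDerivAt_id s).mul_const (inner ℝ (gradient F x) v)
    have h3 := ((hasDerivAt_id s).pow 2).const_mul (L / 2 * ‖v‖ ^ 2)
    refine ((h1.sub h2).sub h3).congr_deriv ?_
    simp only [id_eq, Nat.cast_ofNat, one_mul, mul_one, Nat.add_one_sub_one, pow_one]
    ring
  have hanti : AntitoneOn ψ (Set.Icc 0 1) := by
    refine antitoneOn_of_deriv_nonpos (convex_Icc 0 1)
      (fun s _ => (hψ s).continuousAt.continuousWithinAt)
      (fun s _ => (hψ s).differentiableAt.differentiableWithinAt) fun s hs => ?_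
    rw [interior_Icc] at hs
    rw [(hψ s).deriv, ← inner_sub_left]
    have hlip := hF.gradient_lipschitz (x + s • v) x
    rw [add_sub_cancel_left, norm_smul, Real.norm_of_nonneg hs.1.le] at hlip
    nlinarith [real_inner_le_norm (gradient F (x + s • v) - gradient F x) v,
      mul_le_mul_of_nonneg_right hlip (norm_nonneg v)]
  have h := hanti (Set.left_mem_Icc.2 zero_le_one) (Set.right_mem_Icc.2 zero_le_one) zero_le_one
  simp only [ψ, one_smul, zero_smul, add_zero, zero_mul, one_mul, one_pow, mul_one, ne_eq,
    OfNat.ofNat_ne_zero, not_false_eq_true, zero_pow, mul_zero, sub_zero] at h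
  rw [show x + v = y by simp [hv]] at h
  linarith

/-- Multiplying the descent inequality by the inverse step size `√V` turns the left-hand side into
the unweighted inner product; the terms `√V (F (w t) - F (w (t + 1)))` are then summed by parts,
using that `√V` is nondecreasing and `F` is bounded. -/
theorem IsSmoothWith.sum_inner_le {L M : ℝ} {F : E → ℝ} (hF : IsSmoothWith L F) (hL : 0 ≤ L)
    (hM : ∀ w, |F w| ≤ M) {w g : ℕ → E}
    (hw : ∀ t, w (t + 1) = w t - (1 / √(∑ k ∈ Finset.range (t + 1), ‖g k‖ ^ 2)) • g t) (T : ℕ) :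
    ∑ t ∈ Finset.range T, inner ℝ (gradient F (w t)) (g t) ≤
      (2 * M + L) * √(∑ k ∈ Finset.range T, ‖g k‖ ^ 2) := by
  -- Summation by parts as an induction: the boundary term `(M - F (w T)) √V` is kept in the bound.
  have key : ∑ t ∈ Finset.range T, inner ℝ (gradient F (w t)) (g t) ≤
      (M - F (w T) + L) * √(∑ k ∈ Finset.range T, ‖g k‖ ^ 2) := by
    induction T with
    | zero => simp
    | succ T ih =>
      rw [Finset.sum_range_succ]
      set a := √(∑ k ∈ Finset.range (T + 1), ‖g k‖ ^ 2) with ha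
      set b := √(∑ k ∈ Finset.range T, ‖g k‖ ^ 2) with hb
      have hb0 : 0 ≤ b := Real.sqrt_nonneg _
      have hsq : a ^ 2 = b ^ 2 + ‖g T‖ ^ 2 := by
        rw [ha, hb, Real.sq_sqrt (Finset.sum_nonneg fun _ _ => sq_nonneg _),
          Real.sq_sqrt (Finset.sum_nonneg fun _ _ => sq_nonneg _), Finset.sum_range_succ]
      have hba : b ≤ a := Real.sqrt_le_sqrt <| by
        rw [Finset.sum_range_succ]
        exact le_add_of_nonneg_right (sq_nonneg _)
      have hFM := (abs_le.1 (hM (w T))).2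
      have hstep : inner ℝ (gradient F (w T)) (g T) ≤
          a * (F (w T) - F (w (T + 1))) + L * (a - b) := by
        rcases (hb0.trans hba).eq_or_lt with h0 | hpos
        · -- All estimators vanish so far: the step size is `1 / 0 = 0`, and so is `g T`.
          have hg : g T = 0 := by
            have : ‖g T‖ ^ 2 = 0 := by nlinarith [sq_nonneg ‖g T‖, sq_nonneg b]
            simpa using this
          have : b = 0 := by linarith
          simp [hg, ← h0, this]
        · have h := hF.le_quadratic (w T) (w (T + 1))
          have hd : w (T + 1) - w T = -((1 / a) • g T) := by rw [hw T]; abel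
          rw [hd, inner_neg_right, inner_smul_right, norm_neg, norm_smul, mul_pow,
            Real.norm_of_nonneg (one_div_nonneg.2 hpos.le)] at h
          have h' := mul_le_mul_of_nonneg_left h hpos.le
          have e1 : a * (1 / a * inner ℝ (gradient F (w T)) (g T)) =
              inner ℝ (gradient F (w T)) (g T) := by field_simp
          have e2 : a * ((1 / a) ^ 2 * ‖g T‖ ^ 2) ≤ 2 * (a - b) := by
            have : a * ((1 / a) ^ 2 * ‖g T‖ ^ 2) = ‖g T‖ ^ 2 / a := by field_simp
            rw [this, div_le_iff₀ hpos]
            nlinarith [sq_nonneg (a - b)]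
          nlinarith [mul_le_mul_of_nonneg_left e2 hL]
      nlinarith [mul_le_mul_of_nonneg_left hba (sub_nonneg.2 hFM)]
  refine key.trans (mul_le_mul_of_nonneg_right ?_ (Real.sqrt_nonneg _))
  linarith [(abs_le.1 (hM (w T))).1]

end AdaGrad

/-! ### Functionals of finitely many samples and levels -/

section Finitary

variable {S β γ : Type*}

/-- A functional of a data path and a sequence of levels is finitary at time `t` if it depends only
on the first `t` levels and, once these are given, on finitely many samples. -/
structure IsFinitary (t : ℕ) (X : (ℕ → S) → (ℕ → ℕ) → β) : Prop where
  levels : ∀ z, DependsOn (X z) (Set.Iio t)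
  samples : ∀ j, ∃ n, DependsOn (fun z => X z j) (Set.Iic n)

namespace IsFinitary

variable {t : ℕ} {X : (ℕ → S) → (ℕ → ℕ) → β}

theorem map (hX : IsFinitary t X) (φ : β → γ) : IsFinitary t fun z j => φ (X z j) where
  levels z _ _ h := congrArg φ (hX.levels z h)
  samples j := (hX.samples j).imp fun _ hn _ _ h => congrArg φ (hn h)

theorem map₂ {δ : Type*} {Y : (ℕ → S) → (ℕ → ℕ) → γ} (hX : IsFinitary t X)
    (hY : IsFinitary t Y) (φ : β → γ → δ) : IsFinitary t fun z j => φ (X z j) (Y z j) where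
  levels z _ _ h := congrArg₂ φ (hX.levels z h) (hY.levels z h)
  samples j := by
    obtain ⟨m, hm⟩ := hX.samples j
    obtain ⟨n, hn⟩ := hY.samples j
    exact ⟨max m n, fun z z' h => congrArg₂ φ
      (hm fun i hi => h i (Set.Iic_subset_Iic.2 (le_max_left m n) hi))
      (hn fun i hi => h i (Set.Iic_subset_Iic.2 (le_max_right m n) hi))⟩

theorem mono (hX : IsFinitary t X) {u : ℕ} (h : t ≤ u) : IsFinitary u X :=
  ⟨fun z => (hX.levels z).mono (Set.Iio_subset_Iio h), hX.samples⟩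

theorem const (b : β) : IsFinitary t fun (_ : ℕ → S) (_ : ℕ → ℕ) => b :=
  ⟨fun _ _ _ _ => rfl, fun _ => ⟨0, fun _ _ _ => rfl⟩⟩

theorem level : IsFinitary (t + 1) fun (_ : ℕ → S) (j : ℕ → ℕ) => j t :=
  ⟨fun _ _ _ h => h t (Nat.lt_succ_self t), fun _ => ⟨0, fun _ _ _ => rfl⟩⟩

theorem sum [AddCommMonoid β] {ι : Type*} (s : Finset ι) {X : ι → (ℕ → S) → (ℕ → ℕ) → β}
    (hX : ∀ i ∈ s, IsFinitary t (X i)) : IsFinitary t fun z j => ∑ i ∈ s, X i z j := by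
  classical
  induction s using Finset.induction_on with
  | empty => simpa using const 0
  | insert a s ha ih =>
    simp only [Finset.sum_insert ha]
    exact (hX a (Finset.mem_insert_self a s)).map₂
      (ih fun i hi => hX i (Finset.mem_insert_of_mem hi)) (· + ·)

/-- The first `t` entries of a sequence of levels, continued by zero. -/
def extendLevels (q : Fin t → ℕ) (i : ℕ) : ℕ :=
  if h : i < t then q ⟨i, h⟩ else 0

theorem eq_extendLevels (hX : IsFinitary t X) (z : ℕ → S) (j : ℕ → ℕ) :
    X z j = X z (extendLevels fun i : Fin t => j i) :=
  hX.levels z fun i hi => by simp [extendLevels, Set.mem_Iio.1 hi]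

variable [Finite S] [MeasurableSpace S] [MeasurableSingletonClass S] [MeasurableSpace β]

/-- A finitary functional factors through countably many values of the levels and, for each of
these, through a finite space of samples. -/
theorem measurable (hX : IsFinitary t X) :
    Measurable fun p : (ℕ → S) × (ℕ → ℕ) => X p.1 p.2 := by
  have hfix : ∀ j, Measurable fun z => X z j := by
    intro j
    obtain ⟨n, hn⟩ := hX.samples j
    have h : (fun z => X z j) = (fun x : Fin (n + 1) → S => X (extendPath n x) j) ∘
        fun z i => z i := by
      funext z
      exact hn fun i hi => (forall_eq_extendPath_iff (z := z)).2 rfl i hi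
    rw [h]
    exact (measurable_of_finite _).comp
      (measurable_pi_lambda _ fun i : Fin (n + 1) => measurable_pi_apply (i : ℕ))
  have h : (fun p : (ℕ → S) × (ℕ → ℕ) => X p.1 p.2) =
      (fun p : (ℕ → S) × (Fin t → ℕ) => X p.1 (extendLevels p.2)) ∘
        fun p => (p.1, fun i : Fin t => p.2 i) := by
    funext p
    exact hX.eq_extendLevels p.1 p.2
  rw [h]
  exact (measurable_from_prod_countable_left fun q => hfix (extendLevels q)).comp
    (measurable_fst.prodMk (measurable_pi_lambda _ fun i : Fin t =>
      (measurable_pi_apply (i : ℕ)).comp measurable_snd))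

end IsFinitary

end Finitary

/-! ### Averaging over the samples and over the levels -/

section Decoupling

/-- The Cauchy-Schwarz inequality `E Y ≤ √(E Y²)`. -/
theorem integral_le_sqrt {Ω : Type*} [MeasurableSpace Ω] {ν : Measure Ω}
    [IsProbabilityMeasure ν] {Y : Ω → ℝ} (hY : Integrable Y ν)
    (hY2 : Integrable (fun ω => Y ω ^ 2) ν) {c : ℝ} (hc : 0 < c)
    (h : ∫ ω, Y ω ^ 2 ∂ν ≤ c) : ∫ ω, Y ω ∂ν ≤ √c := by
  have hs : 0 < √c := Real.sqrt_pos.2 hc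
  -- The arithmetic-geometric mean inequality, with equality at `Y ω = √c`.
  have hle : ∀ ω, Y ω ≤ (1 / (2 * √c)) * Y ω ^ 2 + √c / 2 := fun ω => by
    have : (1 / (2 * √c)) * Y ω ^ 2 + √c / 2 - Y ω = (Y ω - √c) ^ 2 / (2 * √c) := by
      field_simp
      ring
    linarith [div_nonneg (sq_nonneg (Y ω - √c)) (by positivity : 0 ≤ 2 * √c)]
  calc ∫ ω, Y ω ∂ν ≤ ∫ ω, ((1 / (2 * √c)) * Y ω ^ 2 + √c / 2) ∂ν :=
        integral_mono hY ((hY2.const_mul _).add (integrable_const _)) hle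
    _ = (1 / (2 * √c)) * ∫ ω, Y ω ^ 2 ∂ν + √c / 2 := by
        rw [integral_add (hY2.const_mul _) (integrable_const _), integral_const_mul]
        simp
    _ ≤ (1 / (2 * √c)) * c + √c / 2 := by gcongr
    _ = √c := by
        nth_rw 2 [← Real.sq_sqrt hc.le]
        field_simp
        norm_num

variable {S Ω : Type*} [Finite S] [MeasurableSpace S] [MeasurableSingletonClass S]
  [MeasurableSpace Ω] {ν : Measure Ω} [IsProbabilityMeasure ν] {Z : ℕ → Ω → S} {J : ℕ → Ω → ℕ}
  {t : ℕ} {X : (ℕ → S) → (ℕ → ℕ) → ℝ} {C : ℝ}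

theorem IsFinitary.integrable (hX : IsFinitary t X) (hC : ∀ z j, |X z j| ≤ C)
    (hZ : ∀ n, Measurable (Z n)) (hJ : ∀ n, Measurable (J n)) :
    Integrable (fun ω => X (fun n => Z n ω) fun n => J n ω) ν :=
  Integrable.of_bound (hX.measurable.comp ((measurable_pi_lambda _ hZ).prodMk
    (measurable_pi_lambda _ hJ))).aestronglyMeasurable C (ae_of_all _ fun _ => hC _ _)

/-- As samples and levels are independent, an expectation may be computed by averaging over the
samples for frozen levels first. -/
theorem IsFinitary.integral_eq_integral_integral (hX : IsFinitary t X) (hC : ∀ z j, |X z j| ≤ C)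
    (hZ : ∀ n, Measurable (Z n)) (hJ : ∀ n, Measurable (J n))
    (hind : IndepFun (fun ω n => Z n ω) (fun ω n => J n ω) ν) :
    ∫ ω, X (fun n => Z n ω) (fun n => J n ω) ∂ν =
      ∫ ω', ∫ ω, X (fun n => Z n ω) (fun n => J n ω') ∂ν ∂ν := by
  have hZm : Measurable fun ω n => Z n ω := measurable_pi_lambda _ hZ
  have hJm : Measurable fun ω n => J n ω := measurable_pi_lambda _ hJ
  have hmap := (indepFun_iff_map_prod_eq_prod_map_map hZm.aemeasurable hJm.aemeasurable).1 hind
  have := Measure.isProbabilityMeasure_map (μ := ν) hZm.aemeasurable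
  have := Measure.isProbabilityMeasure_map (μ := ν) hJm.aemeasurable
  have hint : Integrable (fun p : (ℕ → S) × (ℕ → ℕ) => X p.1 p.2)
      ((ν.map fun ω n => Z n ω).prod (ν.map fun ω n => J n ω)) :=
    Integrable.of_bound hX.measurable.aestronglyMeasurable C (ae_of_all _ fun _ => hC _ _)
  have h1 := integral_map (μ := ν) (hZm.prodMk hJm).aemeasurable
    (hX.measurable.aestronglyMeasurable (μ := ν.map fun ω => (fun n => Z n ω, fun n => J n ω)))
  rw [← h1, hmap, integral_prod_symm _ hint, integral_map hJm.aemeasurable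
    hint.integral_prod_right.aestronglyMeasurable]
  refine integral_congr_ae (ae_of_all _ fun ω' => ?_)
  exact integral_map hZm.aemeasurable
    (hX.measurable.comp (measurable_id.prodMk measurable_const)).aestronglyMeasurable

theorem IsFinitary.integral_le (hX : IsFinitary t X) (hC : ∀ z j, |X z j| ≤ C)
    (hZ : ∀ n, Measurable (Z n)) (hJ : ∀ n, Measurable (J n))
    (hind : IndepFun (fun ω n => Z n ω) (fun ω n => J n ω) ν) {c : ℝ} (hc : 0 ≤ c)
    (h : ∀ j, ∫ ω, X (fun n => Z n ω) j ∂ν ≤ c) :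
    ∫ ω, X (fun n => Z n ω) (fun n => J n ω) ∂ν ≤ c := by
  rw [hX.integral_eq_integral_integral hC hZ hJ hind]
  by_cases hint : Integrable (fun ω' => ∫ ω, X (fun n => Z n ω) (fun n => J n ω') ∂ν) ν
  · exact (integral_mono hint (integrable_const c) fun ω' => h _).trans_eq (by simp)
  · -- Integrability always holds; the junk value `0` makes it unnecessary to prove it here.
    rwa [integral_undef hint]

/-- The level drawn at time `t` is independent of the samples and of the earlier levels. -/
theorem IsFinitary.integral_ite_level (hX : IsFinitary t X) (hC : ∀ z j, |X z j| ≤ C)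
    (hZ : ∀ n, Measurable (Z n)) (hJ : IsIIDGeomHalf ν J)
    (hind : IndepFun (fun ω n => Z n ω) (fun ω n => J n ω) ν) {m : ℕ} (hm : 1 ≤ m) :
    ∫ ω, (if J t ω = m then X (fun n => Z n ω) (fun n => J n ω) else 0) ∂ν =
      (1 / 2) ^ m * ∫ ω, X (fun n => Z n ω) (fun n => J n ω) ∂ν := by
  have hC0 : 0 ≤ C := by
    obtain ⟨ω⟩ := nonempty_of_isProbabilityMeasure ν
    exact (abs_nonneg _).trans (hC (fun n => Z n ω) fun n => J n ω)
  have hY : IsFinitary (t + 1) fun z j => if j t = m then X z j else 0 :=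
    IsFinitary.level.map₂ (hX.mono t.le_succ) fun (l : ℕ) (x : ℝ) => if l = m then x else 0
  rw [hY.integral_eq_integral_integral (C := C) (fun z j => by split_ifs <;> simp [hC, hC0])
    hZ hJ.measurable hind, hX.integral_eq_integral_integral hC hZ hJ.measurable hind]
  set A : (Fin t → ℕ) → ℝ := fun q => ∫ ω, X (fun n => Z n ω) (IsFinitary.extendLevels q) ∂ν
  have hA : ∀ ω', ∫ ω, X (fun n => Z n ω) (fun n => J n ω') ∂ν = A fun i => J i ω' := fun ω' => by
    exact integral_congr_ae (ae_of_all _ fun ω => hX.eq_extendLevels _ _)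
  have hindep : IndepFun (fun ω => if J t ω = m then (1 : ℝ) else 0)
      (fun ω => A fun i => J i ω) ν := by
    have h := hJ.indep.indepFun_finset {t} (Finset.range t) (by simp) hJ.measurable
    exact h.comp (φ := fun q : ({t} : Finset ℕ) → ℕ =>
        if q ⟨t, Finset.mem_singleton_self t⟩ = m then (1 : ℝ) else 0)
      (ψ := fun q : Finset.range t → ℕ => A fun i => q ⟨i, Finset.mem_range.2 i.2⟩)
      (measurable_of_countable _)
      (measurable_of_countable _)
  have hmeas : MeasurableSet {ω | J t ω = m} := hJ.measurable t (measurableSet_singleton m)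
  have hlaw : ∫ ω, (if J t ω = m then (1 : ℝ) else 0) ∂ν = (1 / 2) ^ m := by
    rw [← hJ.law t m hm, ← integral_indicator_one hmeas]
    simp [Set.indicator_apply]
  calc ∫ ω', ∫ ω, (if J t ω' = m then X (fun n => Z n ω) (fun n => J n ω') else 0) ∂ν ∂ν
      = ∫ ω', (if J t ω' = m then (1 : ℝ) else 0) * A (fun i => J i ω') ∂ν := by
        refine integral_congr_ae (ae_of_all _ fun ω' => ?_)
        by_cases h : J t ω' = m <;> simp [h, hA]
    _ = (1 / 2) ^ m * ∫ ω', A (fun i => J i ω') ∂ν := by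
        rw [hindep.integral_fun_mul_eq_mul_integral
          ((measurable_of_countable (fun l : ℕ => if l = m then (1 : ℝ) else 0)).comp
            (hJ.measurable t)).aestronglyMeasurable
          ((measurable_of_countable A).comp (measurable_pi_lambda _ fun i : Fin t =>
            hJ.measurable i)).aestronglyMeasurable, hlaw]
    _ = _ := by simp only [hA]

end Decoupling

/-! ### The iterates of MAG as functionals of samples and levels -/

section Iterates

variable {S E : Type*} [NormedAddCommGroup E] [InnerProductSpace ℝ E] [CompleteSpace E]
  {α : ℝ} {f : E → S → ℝ} {T : ℕ} {r : ℕ → ℕ} {w₁ : E}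

theorem avgGrad_congr {z z' : ℕ → S} {s m : ℕ} (h : ∀ i < 2 ^ m, z (s + i) = z' (s + i)) (w : E) :
    avgGrad f z s m w = avgGrad f z' s m w := by
  unfold avgGrad
  congr 1
  exact Finset.sum_congr rfl fun i hi => by rw [h i (Finset.mem_range.1 hi)]

theorem mlmcGrad_congr (hr : ∀ m, 1 ≤ r m) {z z' : ℕ → S} {s m : ℕ}
    (h : ∀ i < numSamples T r m, z (s + i) = z' (s + i)) (w : E) :
    mlmcGrad f T z s m w = mlmcGrad f T z' s m w := by
  unfold mlmcGrad numSamples at *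
  split_ifs at h ⊢ with hm
  · rw [avgGrad_congr (m := 0) fun i hi => h i (hi.trans_le (Nat.one_le_two_pow)),
      avgGrad_congr h, avgGrad_congr (m := m - 1) fun i hi => h i (hi.trans_le
        (Nat.pow_le_pow_right two_pos (Nat.sub_le m 1)))]
  · rw [avgGrad_congr (m := 0) fun i hi => h i (hi.trans_le (hr m))]

theorem startIndex_succ (j : ℕ → ℕ) (t : ℕ) :
    startIndex T r j (t + 1) = startIndex T r j t + numSamples T r (j t) :=
  Finset.sum_range_succ _ _

theorem magState_congr_samples (hr : ∀ m, 1 ≤ r m) {z z' : ℕ → S} {j : ℕ → ℕ} {t : ℕ}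
    (h : ∀ i < startIndex T r j t, z i = z' i) :
    magState α f T r w₁ z j t = magState α f T r w₁ z' j t := by
  induction t with
  | zero => rfl
  | succ t ih =>
    rw [startIndex_succ] at h
    simp only [magState]
    rw [ih fun i hi => h i (Nat.lt_add_right _ hi),
      mlmcGrad_congr hr fun i hi => h _ (Nat.add_lt_add_left hi _)]

theorem startIndex_congr {j j' : ℕ → ℕ} {t : ℕ} (h : ∀ i < t, j i = j' i) :
    startIndex T r j t = startIndex T r j' t :=
  Finset.sum_congr rfl fun i hi => by rw [h i (Finset.mem_range.1 hi)]

theorem magState_congr_levels {z : ℕ → S} {j j' : ℕ → ℕ} {t : ℕ} (h : ∀ i < t, j i = j' i) :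
    magState α f T r w₁ z j t = magState α f T r w₁ z j' t := by
  induction t with
  | zero => rfl
  | succ t ih =>
    have h' : ∀ i < t, j i = j' i := fun i hi => h i (Nat.lt_succ_of_lt hi)
    simp only [magState]
    rw [ih h', startIndex_congr h', h t (Nat.lt_succ_self t)]

variable (α f T r w₁) in
/-- The average `g_t^m` of the first `2 ^ m` stochastic gradients of iteration `t`, as a functional
of the data path and the levels. -/
def levelGrad (t m : ℕ) (z : ℕ → S) (j : ℕ → ℕ) : E :=
  avgGrad f z (startIndex T r j t) m (magIterate α f T r w₁ z j t)

theorem isFinitary_magIterate (hr : ∀ m, 1 ≤ r m) (t : ℕ) :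
    IsFinitary t fun z j => magIterate α f T r w₁ z j t where
  levels _ _ _ h := congrArg Prod.fst (magState_congr_levels h)
  samples j := ⟨startIndex T r j t, fun _ _ h =>
    congrArg Prod.fst (magState_congr_samples hr fun i hi => h i hi.le)⟩

theorem isFinitary_levelGrad (hr : ∀ m, 1 ≤ r m) (t m : ℕ) :
    IsFinitary t (levelGrad α f T r w₁ t m) where
  levels z j j' h := by
    rw [levelGrad, levelGrad, magIterate, magIterate, startIndex_congr h, magState_congr_levels h]
  samples j := ⟨startIndex T r j t + 2 ^ m, fun z z' h => by
    simp only [levelGrad, magIterate]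
    rw [magState_congr_samples hr fun i hi => h i (hi.le.trans (Nat.le_add_right _ _)),
      avgGrad_congr fun i hi => h _ (Nat.add_le_add_left hi.le _)]⟩

theorem isFinitary_magGrad (hr : ∀ m, 1 ≤ r m) (t : ℕ) :
    IsFinitary (t + 1) fun z j => magGrad α f T r w₁ z j t where
  levels z j j' h := by
    have h' : ∀ i < t, j i = j' i := fun i hi => h i (Nat.lt_succ_of_lt hi)
    simp only [magGrad, magIterate]
    rw [magState_congr_levels h', startIndex_congr h', h t (Nat.lt_succ_self t)]
  samples j := ⟨startIndex T r j (t + 1), fun z z' h => by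
    rw [startIndex_succ] at h
    simp only [magGrad, magIterate]
    rw [magState_congr_samples hr fun i hi => h i (hi.le.trans (Nat.le_add_right _ _)),
      mlmcGrad_congr hr fun i hi => h _ (Nat.add_le_add_left hi.le _)]⟩

theorem magGrad_eq_sum (hT : 1 ≤ T) (z : ℕ → S) (j : ℕ → ℕ) (t : ℕ) :
    magGrad α f T r w₁ z j t = levelGrad α f T r w₁ t 0 z j +
      ∑ m ∈ Finset.range (Nat.log 2 T), if j t = m + 1 then (2 : ℝ) ^ (m + 1) •
        (levelGrad α f T r w₁ t (m + 1) z j - levelGrad α f T r w₁ t m z j) else 0 := by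
  unfold magGrad mlmcGrad
  refine congrArg₂ (· + ·) rfl ?_
  have hlog : ∀ m, 2 ^ m ≤ T ↔ m ≤ Nat.log 2 T := fun m =>
    (Nat.le_log_iff_pow_le one_lt_two (by omega)).symm
  rcases hj : j t with _ | l
  · simp
  · by_cases hl : l + 1 ≤ Nat.log 2 T
    · rw [if_pos ((hlog _).2 hl), Finset.sum_eq_single l]
      · simp [levelGrad]
      · intro m _ hm
        rw [if_neg (by omega)]
      · intro h
        exact absurd (Finset.mem_range.2 hl) h
    · rw [if_neg fun h => hl ((hlog _).1 h), Finset.sum_eq_zero]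
      intro m hm
      rw [if_neg]
      have := Finset.mem_range.1 hm
      omega

theorem norm_magGrad_sq_le (hT : 1 ≤ T) (z : ℕ → S) (j : ℕ → ℕ) (t : ℕ) :
    ‖magGrad α f T r w₁ z j t‖ ^ 2 ≤ 2 * ‖levelGrad α f T r w₁ t 0 z j‖ ^ 2 +
      ∑ m ∈ Finset.range (Nat.log 2 T), if j t = m + 1 then 2 * 4 ^ (m + 1) *
        ‖levelGrad α f T r w₁ t (m + 1) z j - levelGrad α f T r w₁ t m z j‖ ^ 2 else 0 := by
  have hadd : ∀ a b : E, ‖a + b‖ ^ 2 ≤ 2 * ‖a‖ ^ 2 + 2 * ‖b‖ ^ 2 := fun a b => by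
    nlinarith [norm_add_le a b, norm_nonneg (a + b), sq_nonneg (‖a‖ - ‖b‖)]
  rw [magGrad_eq_sum hT]
  refine (hadd _ _).trans (add_le_add_right (le_of_eq ?_) _)
  -- At most one summand is nonzero.
  by_cases h : ∃ m ∈ Finset.range (Nat.log 2 T), j t = m + 1
  · obtain ⟨l, hl, hj⟩ := h
    have hne : ∀ m ∈ Finset.range (Nat.log 2 T), m ≠ l → ¬ j t = m + 1 := fun m _ hm => by omega
    rw [Finset.sum_eq_single_of_mem l hl fun m hm hml => if_neg (hne m hm hml),
      Finset.sum_eq_single_of_mem l hl fun m hm hml => if_neg (hne m hm hml), if_pos hj,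
      if_pos hj, norm_smul, mul_pow, Real.norm_of_nonneg (by positivity), ← pow_mul,
      mul_comm (l + 1), pow_mul]
    norm_num
    ring
  · push Not at h
    rw [Finset.sum_eq_zero fun m hm => if_neg (h m hm),
      Finset.sum_eq_zero fun m hm => if_neg (h m hm)]
    simp

variable {G : ℝ}

theorem norm_avgGrad_le (hG : ∀ w z, ‖gradient (fun v => f v z) w‖ ≤ G) (z : ℕ → S) (s m : ℕ)
    (w : E) : ‖avgGrad f z s m w‖ ≤ G := by
  rw [avgGrad, norm_smul, Real.norm_of_nonneg (by positivity)]
  calc 1 / (2 : ℝ) ^ m * ‖∑ i ∈ Finset.range (2 ^ m), gradient (fun v => f v (z (s + i))) w‖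
      ≤ 1 / (2 : ℝ) ^ m * (2 ^ m * G) := by
        gcongr
        simpa using norm_sum_le_of_le (Finset.range (2 ^ m)) fun i _ => hG w (z (s + i))
    _ = G := by field_simp

theorem norm_magGrad_le (hG0 : 0 ≤ G) (hG : ∀ w z, ‖gradient (fun v => f v z) w‖ ≤ G)
    (z : ℕ → S) (j : ℕ → ℕ) (t : ℕ) : ‖magGrad α f T r w₁ z j t‖ ≤ (1 + 2 * T) * G := by
  unfold magGrad mlmcGrad
  set w := magIterate α f T r w₁ z j t
  refine (norm_add_le _ _).trans ?_
  rw [add_mul, one_mul]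
  refine add_le_add (norm_avgGrad_le hG _ _ _ _) ?_
  split_ifs with h
  · rw [norm_smul, Real.norm_of_nonneg (by positivity), mul_comm 2 (T : ℝ), mul_assoc, two_mul]
    have h' : (2 : ℝ) ^ j t ≤ T := by exact_mod_cast h
    exact mul_le_mul h' ((norm_sub_le _ _).trans
      (add_le_add (norm_avgGrad_le hG _ _ _ _) (norm_avgGrad_le hG _ _ _ _)))
      (norm_nonneg _) (Nat.cast_nonneg T)
  · rw [norm_zero]
    positivity

theorem gradient_objective [Fintype S] {μ : S → ℝ} (hf : ∀ z, Differentiable ℝ fun w => f w z)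
    (w : E) : gradient (objective f μ) w = ∑ y, μ y • gradient (fun v => f v y) w := by
  refine HasGradientAt.gradient ?_
  rw [hasGradientAt_iff_hasFDerivAt, map_sum]
  simp only [map_smulₛₗ]
  exact HasFDerivAt.fun_sum fun y _ =>
    ((hf y w).hasGradientAt.hasFDerivAt).const_mul (μ y)

theorem norm_gradient_objective_le [Fintype S] {μ : S → ℝ} (hμ : μ ∈ stdSimplex ℝ S)
    (hf : ∀ z, Differentiable ℝ fun w => f w z)
    (hG : ∀ w z, ‖gradient (fun v => f v z) w‖ ≤ G) (w : E) :
    ‖gradient (objective f μ) w‖ ≤ G := by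
  rw [gradient_objective hf]
  calc ‖∑ y, μ y • gradient (fun v => f v y) w‖ ≤ ∑ y, μ y * G := by
        refine norm_sum_le_of_le _ fun y _ => ?_
        rw [norm_smul, Real.norm_of_nonneg (hμ.1 y)]
        exact mul_le_mul_of_nonneg_left (hG w y) (hμ.1 y)
    _ = G := by rw [← Finset.sum_mul, hμ.2, one_mul]

end Iterates

/-! ### Bias and second moment of the multi-level estimator -/

theorem abs_norm_sub_sq_le {E : Type*} [SeminormedAddCommGroup E] {a b : E} {G : ℝ}
    (ha : ‖a‖ ≤ G) (hb : ‖b‖ ≤ G) : |‖a - b‖ ^ 2| ≤ (2 * G) ^ 2 := by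
  rw [abs_of_nonneg (sq_nonneg _)]
  exact pow_le_pow_left₀ (norm_nonneg _) ((norm_sub_le _ _).trans (by linarith)) 2

/-- The standing assumptions on the chain, the levels and the loss functions. -/
structure Setting {S E Ω : Type*} [Fintype S] [DecidableEq S] [MeasurableSpace S]
    [NormedAddCommGroup E] [InnerProductSpace ℝ E] [CompleteSpace E] [MeasurableSpace Ω]
    (ν : Measure Ω) (P : Matrix S S ℝ) (μ : S → ℝ) (f : E → S → ℝ) (G : ℝ) (Z : ℕ → Ω → S)
    (J : ℕ → Ω → ℕ) (r : ℕ → ℕ) : Prop where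
  ergodic : IsErgodic P
  stationary : IsStationary P μ
  G_pos : 0 < G
  differentiable : ∀ z, Differentiable ℝ fun w => f w z
  norm_gradient_le : ∀ w z, ‖gradient (fun v => f v z) w‖ ≤ G
  chain : IsMarkovChain ν P Z
  geom : IsIIDGeomHalf ν J
  indep : IndepFun (fun ω n => Z n ω) (fun ω t => J t ω) ν
  one_le_r : ∀ m, 1 ≤ r m

namespace Setting

variable {S E Ω : Type*} [Fintype S] [DecidableEq S] [MeasurableSpace S]
  [NormedAddCommGroup E] [InnerProductSpace ℝ E] [CompleteSpace E]
  [MeasurableSpace Ω] {ν : Measure Ω} {P : Matrix S S ℝ} {μ : S → ℝ}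
  {f : E → S → ℝ} {G : ℝ} {Z : ℕ → Ω → S} {J : ℕ → Ω → ℕ} {r : ℕ → ℕ} {α : ℝ} {T : ℕ} {w₁ : E}

theorem norm_gradient_objective_le (h : Setting ν P μ f G Z J r) (w : E) :
    ‖gradient (objective f μ) w‖ ≤ G :=
  MAG.norm_gradient_objective_le h.stationary.mem_simplex h.differentiable h.norm_gradient_le w

theorem norm_levelGrad_le (h : Setting ν P μ f G Z J r) (t m : ℕ) (z : ℕ → S) (j : ℕ → ℕ) :
    ‖levelGrad α f T r w₁ t m z j‖ ≤ G :=
  norm_avgGrad_le h.norm_gradient_le _ _ _ _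

theorem abs_inner_gradient_le (h : Setting ν P μ f G Z J r) (w : E) {b : E} {c : ℝ}
    (hb : ‖b‖ ≤ c) : |inner ℝ (gradient (objective f μ) w) b| ≤ G * c :=
  (abs_real_inner_le_norm _ _).trans (mul_le_mul (h.norm_gradient_objective_le w) hb
    (norm_nonneg _) h.G_pos.le)

theorem isFinitary_gradient (h : Setting ν P μ f G Z J r) (t : ℕ) :
    IsFinitary t fun z j => gradient (objective f μ) (magIterate α f T r w₁ z j t) :=
  (isFinitary_magIterate h.one_le_r t).map _

theorem isFinitary_sq_error (h : Setting ν P μ f G Z J r) (t m : ℕ) :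
    IsFinitary t fun z j => ‖levelGrad α f T r w₁ t m z j -
      gradient (objective f μ) (magIterate α f T r w₁ z j t)‖ ^ 2 :=
  (isFinitary_levelGrad h.one_le_r t m).map₂ (h.isFinitary_gradient t) fun a b => ‖a - b‖ ^ 2

variable [IsProbabilityMeasure ν]

theorem mixingTime_spec (h : Setting ν P μ f G Z J r) :
    1 ≤ mixingTime P μ ∧ dmix P μ (mixingTime P μ) ≤ 1 / 4 := by
  obtain ⟨ω⟩ := nonempty_of_isProbabilityMeasure ν
  have : Nonempty S := ⟨Z 0 ω⟩
  exact h.ergodic.mixingTime_spec h.stationary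

variable [MeasurableSingletonClass S]

/-- For frozen levels the iterate is determined by the samples before the window, so the bound for
averages along the chain applies at this iterate. -/
theorem integral_sq_error_le_of_levels (h : Setting ν P μ f G Z J r) (t m : ℕ) (j : ℕ → ℕ) :
    ∫ ω, ‖levelGrad α f T r w₁ t m (fun n => Z n ω) j -
      gradient (objective f μ) (magIterate α f T r w₁ (fun n => Z n ω) j t)‖ ^ 2 ∂ν ≤
      16 * mixingTime P μ * G ^ 2 / 2 ^ m := by
  set H : (ℕ → S) → S → E := fun z y =>
    gradient (fun v => f v y) (magIterate α f T r w₁ z j t) -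
      gradient (objective f μ) (magIterate α f T r w₁ z j t) with hHdef
  have hH : DependsOn H (Set.Iio (startIndex T r j t)) := fun z z' hz => by
    simp only [hHdef, magIterate]
    rw [magState_congr_samples h.one_le_r hz]
  have hB : ∀ z y, ‖H z y‖ ≤ 2 * G := fun z y => (norm_sub_le _ _).trans (by
    linarith [h.norm_gradient_le (magIterate α f T r w₁ z j t) y,
      h.norm_gradient_objective_le (magIterate α f T r w₁ z j t)])
  have hmean : ∀ z, ∑ y, μ y • H z y = 0 := fun z => by
    simp only [hHdef, smul_sub, Finset.sum_sub_distrib, ← Finset.sum_smul,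
      h.stationary.mem_simplex.2, one_smul, ← gradient_objective h.differentiable, sub_self]
  have hmain := h.chain.integral_norm_sum_sq_le h.ergodic.stochastic h.stationary
    h.mixingTime_spec.1 h.mixingTime_spec.2 hH (by linarith [h.G_pos]) hB hmean (2 ^ m)
  have heq : ∀ z, levelGrad α f T r w₁ t m z j -
      gradient (objective f μ) (magIterate α f T r w₁ z j t) =
      (1 / (2 : ℝ) ^ m) • ∑ i ∈ Finset.range (2 ^ m), H z (z (startIndex T r j t + i)) := by
    intro z
    rw [Finset.sum_sub_distrib, smul_sub, Finset.sum_const, Finset.card_range,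
      ← Nat.cast_smul_eq_nsmul ℝ, smul_smul]
    push_cast
    rw [one_div_mul_cancel (by positivity), one_smul]
    rfl
  simp only [heq, norm_smul, mul_pow]
  rw [integral_const_mul, Real.norm_of_nonneg (by positivity)]
  calc _ ≤ (1 / (2 : ℝ) ^ m) ^ 2 * (4 * ((2 ^ m : ℕ) : ℝ) * mixingTime P μ * (2 * G) ^ 2) :=
        mul_le_mul_of_nonneg_left hmain (by positivity)
    _ = 16 * mixingTime P μ * G ^ 2 / 2 ^ m := by
        push_cast
        field_simp
        ring

theorem integral_sq_error_le (h : Setting ν P μ f G Z J r) (t m : ℕ) :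
    ∫ ω, ‖levelGrad α f T r w₁ t m (fun n => Z n ω) (fun n => J n ω) -
      gradient (objective f μ)
        (magIterate α f T r w₁ (fun n => Z n ω) (fun n => J n ω) t)‖ ^ 2 ∂ν ≤
      16 * mixingTime P μ * G ^ 2 / 2 ^ m :=
  (h.isFinitary_sq_error t m).integral_le (fun z j => abs_norm_sub_sq_le
    (h.norm_levelGrad_le t m z j) (h.norm_gradient_objective_le _)) h.chain.measurable
    h.geom.measurable h.indep (by positivity) fun j => h.integral_sq_error_le_of_levels t m j

/-- The levels are weighted so that the expectation of the estimator telescopes: on average it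
agrees with the longest average that it may use. -/
theorem integral_inner_magGrad (h : Setting ν P μ f G Z J r) (hT : 1 ≤ T) (t : ℕ) :
    ∫ ω, inner ℝ (gradient (objective f μ)
        (magIterate α f T r w₁ (fun n => Z n ω) (fun n => J n ω) t))
        (magGrad α f T r w₁ (fun n => Z n ω) (fun n => J n ω) t) ∂ν =
      ∫ ω, inner ℝ (gradient (objective f μ)
        (magIterate α f T r w₁ (fun n => Z n ω) (fun n => J n ω) t))
        (levelGrad α f T r w₁ t (Nat.log 2 T) (fun n => Z n ω) (fun n => J n ω)) ∂ν := by
  set K := Nat.log 2 T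
  set D : (ℕ → S) → (ℕ → ℕ) → E :=
    fun z j => gradient (objective f μ) (magIterate α f T r w₁ z j t) with hD
  have hinner : ∀ m, IsFinitary t fun z j => inner ℝ (D z j) (levelGrad α f T r w₁ t m z j) :=
    fun m => (h.isFinitary_gradient t).map₂ (isFinitary_levelGrad h.one_le_r t m) (inner ℝ)
  have hint : ∀ m, Integrable (fun ω => inner ℝ (D (fun n => Z n ω) fun n => J n ω)
      (levelGrad α f T r w₁ t m (fun n => Z n ω) fun n => J n ω)) ν := fun m =>
    (hinner m).integrable (fun z j => h.abs_inner_gradient_le _ (h.norm_levelGrad_le t m z j))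
      h.chain.measurable h.geom.measurable
  set X : ℕ → (ℕ → S) → (ℕ → ℕ) → ℝ := fun m z j => 2 ^ (m + 1) *
    (inner ℝ (D z j) (levelGrad α f T r w₁ t (m + 1) z j) -
      inner ℝ (D z j) (levelGrad α f T r w₁ t m z j)) with hX
  have hXfin : ∀ m, IsFinitary t (X m) := fun m =>
    (hinner (m + 1)).map₂ (hinner m) fun a b => 2 ^ (m + 1) * (a - b)
  have hXb : ∀ m z j, |X m z j| ≤ 2 ^ (m + 1) * (G * G + G * G) := fun m z j => by
    rw [hX, abs_mul, abs_of_pos (by positivity)]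
    exact mul_le_mul_of_nonneg_left ((abs_sub _ _).trans (add_le_add
      (h.abs_inner_gradient_le _ (h.norm_levelGrad_le _ _ _ _))
      (h.abs_inner_gradient_le _ (h.norm_levelGrad_le _ _ _ _)))) (by positivity)
  have hitefin : ∀ m, IsFinitary (t + 1) fun z j => if j t = m + 1 then X m z j else 0 := fun m =>
    IsFinitary.level.map₂ ((hXfin m).mono t.le_succ)
      fun (l : ℕ) (x : ℝ) => if l = m + 1 then x else 0
  have hiteint : ∀ m, Integrable (fun ω => if J t ω = m + 1 then
      X m (fun n => Z n ω) (fun n => J n ω) else 0) ν := fun m =>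
    (hitefin m).integrable (C := 2 ^ (m + 1) * (G * G + G * G)) (fun z j => by
      split_ifs
      · exact hXb m z j
      · rw [abs_zero]
        have := h.G_pos
        positivity) h.chain.measurable h.geom.measurable
  have hdecomp : ∀ z j, inner ℝ (D z j) (magGrad α f T r w₁ z j t) =
      inner ℝ (D z j) (levelGrad α f T r w₁ t 0 z j) +
        ∑ m ∈ Finset.range K, if j t = m + 1 then X m z j else 0 := fun z j => by
    rw [magGrad_eq_sum hT, inner_add_right, inner_sum]
    congr 1
    refine Finset.sum_congr rfl fun m _ => ?_
    split_ifs
    · rw [inner_smul_right, inner_sub_right]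
    · exact inner_zero_right _
  have hlevel : ∀ m, ∫ ω, (if J t ω = m + 1 then
      X m (fun n => Z n ω) (fun n => J n ω) else 0) ∂ν =
      ∫ ω, inner ℝ (D (fun n => Z n ω) fun n => J n ω)
        (levelGrad α f T r w₁ t (m + 1) (fun n => Z n ω) fun n => J n ω) ∂ν -
      ∫ ω, inner ℝ (D (fun n => Z n ω) fun n => J n ω)
        (levelGrad α f T r w₁ t m (fun n => Z n ω) fun n => J n ω) ∂ν := fun m => by
    rw [(hXfin m).integral_ite_level (hXb m) h.chain.measurable h.geom h.indep (by omega),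
      hX, integral_const_mul, integral_sub (hint (m + 1)) (hint m), ← mul_assoc, ← mul_pow]
    norm_num
  change ∫ ω, inner ℝ (D (fun n => Z n ω) fun n => J n ω) _ ∂ν = ∫ ω, inner ℝ (D _ _) _ ∂ν
  simp only [hdecomp]
  rw [integral_add (hint 0) (integrable_finsetSum _ fun m _ => hiteint m),
    integral_finsetSum _ fun m _ => hiteint m, Finset.sum_congr rfl fun m _ => hlevel m,
    Finset.sum_range_sub fun m => ∫ ω, inner ℝ (D (fun n => Z n ω) fun n => J n ω)
      (levelGrad α f T r w₁ t m (fun n => Z n ω) fun n => J n ω) ∂ν, add_sub_cancel]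

/-- The differences of consecutive averages have second moment of order `τ G² / 2 ^ m`, which
balances the weight `4 ^ m` and the probability `2 ^ (-m)` of level `m`: every level contributes
order `τ G²`. -/
theorem integral_norm_magGrad_sq_le (h : Setting ν P μ f G Z J r) (hT : 1 ≤ T) (t : ℕ) :
    ∫ ω, ‖magGrad α f T r w₁ (fun n => Z n ω) (fun n => J n ω) t‖ ^ 2 ∂ν ≤
      2 * G ^ 2 + Nat.log 2 T * (192 * mixingTime P μ * G ^ 2) := by
  set τ : ℝ := (mixingTime P μ : ℝ)
  set K := Nat.log 2 T
  set X : ℕ → (ℕ → S) → (ℕ → ℕ) → ℝ := fun m z j => 2 * 4 ^ (m + 1) *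
    ‖levelGrad α f T r w₁ t (m + 1) z j - levelGrad α f T r w₁ t m z j‖ ^ 2 with hX
  have hXfin : ∀ m, IsFinitary t (X m) := fun m =>
    (isFinitary_levelGrad h.one_le_r t (m + 1)).map₂ (isFinitary_levelGrad h.one_le_r t m)
      fun a b => 2 * 4 ^ (m + 1) * ‖a - b‖ ^ 2
  have hXb : ∀ m z j, |X m z j| ≤ 2 * 4 ^ (m + 1) * (2 * G) ^ 2 := fun m z j => by
    rw [hX, abs_mul, abs_of_pos (by positivity)]
    exact mul_le_mul_of_nonneg_left (abs_norm_sub_sq_le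
      (h.norm_levelGrad_le _ _ _ _) (h.norm_levelGrad_le _ _ _ _)) (by positivity)
  have hitefin : ∀ m, IsFinitary (t + 1) fun z j => if j t = m + 1 then X m z j else 0 := fun m =>
    IsFinitary.level.map₂ ((hXfin m).mono t.le_succ)
      fun (l : ℕ) (x : ℝ) => if l = m + 1 then x else 0
  have hiteint : ∀ m, Integrable (fun ω => if J t ω = m + 1 then
      X m (fun n => Z n ω) (fun n => J n ω) else 0) ν := fun m =>
    (hitefin m).integrable (C := 2 * 4 ^ (m + 1) * (2 * G) ^ 2) (fun z j => by
      split_ifs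
      · exact hXb m z j
      · rw [abs_zero]
        positivity) h.chain.measurable h.geom.measurable
  have hsq : ∀ m, Integrable (fun ω => ‖levelGrad α f T r w₁ t m (fun n => Z n ω)
      (fun n => J n ω) - gradient (objective f μ)
        (magIterate α f T r w₁ (fun n => Z n ω) (fun n => J n ω) t)‖ ^ 2) ν := fun m =>
    (h.isFinitary_sq_error t m).integrable (fun z j => abs_norm_sub_sq_le
      (h.norm_levelGrad_le t m z j) (h.norm_gradient_objective_le _)) h.chain.measurable
      h.geom.measurable
  have hlevel : ∀ m, ∫ ω, (if J t ω = m + 1 then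
      X m (fun n => Z n ω) (fun n => J n ω) else 0) ∂ν ≤ 192 * τ * G ^ 2 := fun m => by
    rw [(hXfin m).integral_ite_level (hXb m) h.chain.measurable h.geom h.indep (by omega)]
    have hle : ∫ ω, X m (fun n => Z n ω) (fun n => J n ω) ∂ν ≤
        2 * 4 ^ (m + 1) * (2 * (16 * τ * G ^ 2 / 2 ^ (m + 1)) + 2 * (16 * τ * G ^ 2 / 2 ^ m)) := by
      rw [hX, integral_const_mul]
      refine mul_le_mul_of_nonneg_left ?_ (by positivity)
      refine (integral_mono_of_nonneg (ae_of_all _ fun ω => sq_nonneg _)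
        (((hsq (m + 1)).const_mul 2).add ((hsq m).const_mul 2)) (ae_of_all _ fun ω => ?_)).trans ?_
      · set a := levelGrad α f T r w₁ t (m + 1) (fun n => Z n ω) fun n => J n ω
        set b := levelGrad α f T r w₁ t m (fun n => Z n ω) fun n => J n ω
        set c := gradient (objective f μ)
          (magIterate α f T r w₁ (fun n => Z n ω) (fun n => J n ω) t)
        change ‖a - b‖ ^ 2 ≤ 2 * ‖a - c‖ ^ 2 + 2 * ‖b - c‖ ^ 2
        have htri : ‖a - b‖ ≤ ‖a - c‖ + ‖b - c‖ := by
          rw [← norm_neg (b - c), neg_sub]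
          exact norm_sub_le_norm_sub_add_norm_sub a c b
        nlinarith [norm_nonneg (a - b), sq_nonneg (‖a - c‖ - ‖b - c‖)]
      · rw [integral_add' ((hsq (m + 1)).const_mul 2) ((hsq m).const_mul 2), integral_const_mul,
          integral_const_mul]
        gcongr
        · exact h.integral_sq_error_le t (m + 1)
        · exact h.integral_sq_error_le t m
    refine (mul_le_mul_of_nonneg_left hle (by positivity)).trans_eq ?_
    rw [show (4 : ℝ) = 2 * 2 by norm_num, mul_pow, one_div, inv_pow]
    field_simp
    ring
  have hzero : Integrable (fun ω => ‖levelGrad α f T r w₁ t 0 (fun n => Z n ω)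
      fun n => J n ω‖ ^ 2) ν :=
    ((isFinitary_levelGrad h.one_le_r t 0).map fun a => ‖a‖ ^ 2).integrable (C := G ^ 2)
      (fun z j => by
        rw [abs_of_nonneg (sq_nonneg _)]
        exact pow_le_pow_left₀ (norm_nonneg _) (h.norm_levelGrad_le t 0 z j) 2)
      h.chain.measurable h.geom.measurable
  calc ∫ ω, ‖magGrad α f T r w₁ (fun n => Z n ω) (fun n => J n ω) t‖ ^ 2 ∂ν
      ≤ ∫ ω, (2 * ‖levelGrad α f T r w₁ t 0 (fun n => Z n ω) fun n => J n ω‖ ^ 2 +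
          ∑ m ∈ Finset.range K, if J t ω = m + 1 then
            X m (fun n => Z n ω) (fun n => J n ω) else 0) ∂ν :=
        integral_mono_of_nonneg (ae_of_all _ fun ω => sq_nonneg _)
          ((hzero.const_mul 2).add (integrable_finsetSum _ fun m _ => hiteint m))
          (ae_of_all _ fun ω => norm_magGrad_sq_le hT _ _ t)
    _ = 2 * ∫ ω, ‖levelGrad α f T r w₁ t 0 (fun n => Z n ω) fun n => J n ω‖ ^ 2 ∂ν +
          ∑ m ∈ Finset.range K, ∫ ω, (if J t ω = m + 1 then
            X m (fun n => Z n ω) (fun n => J n ω) else 0) ∂ν := by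
        rw [integral_add (hzero.const_mul 2) (integrable_finsetSum _ fun m _ => hiteint m),
          integral_finsetSum _ fun m _ => hiteint m, integral_const_mul]
    _ ≤ 2 * G ^ 2 + K * (192 * τ * G ^ 2) := by
        refine add_le_add (mul_le_mul_of_nonneg_left ?_ zero_le_two) ?_
        · refine (integral_mono hzero (integrable_const (G ^ 2)) fun ω => ?_).trans_eq (by simp)
          exact pow_le_pow_left₀ (norm_nonneg _) (h.norm_levelGrad_le t 0 _ _) 2
        · simpa using Finset.sum_le_card_nsmul (Finset.range K) _ _ fun m _ => hlevel m

theorem integrable_norm_gradient_sq (h : Setting ν P μ f G Z J r) (t : ℕ) :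
    Integrable (fun ω => ‖gradient (objective f μ)
      (magIterate α f T r w₁ (fun n => Z n ω) (fun n => J n ω) t)‖ ^ 2) ν :=
  ((h.isFinitary_gradient t).map fun a => ‖a‖ ^ 2).integrable (C := G ^ 2) (fun z j => by
    rw [abs_of_nonneg (sq_nonneg _)]
    exact pow_le_pow_left₀ (norm_nonneg _) (h.norm_gradient_objective_le _) 2)
    h.chain.measurable h.geom.measurable

/-- The bias of the estimator is at most the root mean square error of the longest average. -/
theorem integral_norm_gradient_sq_le (h : Setting ν P μ f G Z J r) (hT : 1 ≤ T) (t : ℕ) :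
    ∫ ω, ‖gradient (objective f μ)
      (magIterate α f T r w₁ (fun n => Z n ω) (fun n => J n ω) t)‖ ^ 2 ∂ν ≤
      ∫ ω, inner ℝ (gradient (objective f μ)
        (magIterate α f T r w₁ (fun n => Z n ω) (fun n => J n ω) t))
        (magGrad α f T r w₁ (fun n => Z n ω) (fun n => J n ω) t) ∂ν +
      G * √(16 * mixingTime P μ * G ^ 2 / 2 ^ Nat.log 2 T) := by
  rw [h.integral_inner_magGrad hT]
  set K := Nat.log 2 T
  have herr : Integrable (fun ω => ‖levelGrad α f T r w₁ t K (fun n => Z n ω)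
      (fun n => J n ω) - gradient (objective f μ)
        (magIterate α f T r w₁ (fun n => Z n ω) (fun n => J n ω) t)‖) ν :=
    ((isFinitary_levelGrad h.one_le_r t K).map₂ (h.isFinitary_gradient t)
      fun a b => ‖a - b‖).integrable (C := G + G) (fun z j => by
        rw [abs_norm]
        exact (norm_sub_le _ _).trans (add_le_add (h.norm_levelGrad_le _ _ _ _)
          (h.norm_gradient_objective_le _))) h.chain.measurable h.geom.measurable
  have herr2 := (h.isFinitary_sq_error (α := α) (T := T) (w₁ := w₁) t K).integrable (ν := ν)
    (fun z j => abs_norm_sub_sq_le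
      (h.norm_levelGrad_le t K z j) (h.norm_gradient_objective_le _)) h.chain.measurable
      h.geom.measurable
  have hin : Integrable (fun ω => inner ℝ (gradient (objective f μ)
      (magIterate α f T r w₁ (fun n => Z n ω) (fun n => J n ω) t))
      (levelGrad α f T r w₁ t K (fun n => Z n ω) (fun n => J n ω))) ν :=
    ((h.isFinitary_gradient t).map₂ (isFinitary_levelGrad h.one_le_r t K) (inner ℝ)).integrable
      (fun z j => h.abs_inner_gradient_le _ (h.norm_levelGrad_le t K z j))
      h.chain.measurable h.geom.measurable
  have hτ : (0 : ℝ) < mixingTime P μ := by exact_mod_cast h.mixingTime_spec.1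
  have hG := h.G_pos
  have hsqrt := integral_le_sqrt herr herr2 (c := 16 * mixingTime P μ * G ^ 2 / 2 ^ K)
    (by positivity) (h.integral_sq_error_le t K)
  refine (integral_mono (h.integrable_norm_gradient_sq t) (hin.add (herr.const_mul G))
    fun ω => ?_).trans ?_
  · set a := levelGrad α f T r w₁ t K (fun n => Z n ω) fun n => J n ω
    set w := magIterate α f T r w₁ (fun n => Z n ω) (fun n => J n ω) t
    change ‖gradient (objective f μ) w‖ ^ 2 ≤ inner ℝ (gradient (objective f μ) w) a +
      G * ‖a - gradient (objective f μ) w‖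
    have hab := neg_le_of_abs_le (h.abs_inner_gradient_le w
      (le_refl ‖a - gradient (objective f μ) w‖))
    rw [inner_sub_right, real_inner_self_eq_norm_sq] at hab
    linarith
  · rw [integral_add' hin (herr.const_mul G), integral_const_mul]
    gcongr

/-- The regret bound in expectation; the square root is moved outside by Cauchy-Schwarz. -/
theorem sum_integral_inner_le (h : Setting ν P μ f G Z J r) {L M : ℝ} (hL : 0 ≤ L) (hM0 : 0 ≤ M)
    (hF : IsSmoothWith L (objective f μ)) (hM : ∀ w, |objective f μ w| ≤ M) (hT : 1 ≤ T) :
    ∑ t ∈ Finset.range T, ∫ ω, inner ℝ (gradient (objective f μ)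
        (magIterate 1 f T r w₁ (fun n => Z n ω) (fun n => J n ω) t))
        (magGrad 1 f T r w₁ (fun n => Z n ω) (fun n => J n ω) t) ∂ν ≤
      (2 * M + L) * √(T * (2 * G ^ 2 + Nat.log 2 T * (192 * mixingTime P μ * G ^ 2))) := by
  have hG := h.G_pos
  have hsq : ∀ t z j, |‖magGrad 1 f T r w₁ z j t‖ ^ 2| ≤ ((1 + 2 * T) * G) ^ 2 := fun t z j => by
    rw [abs_of_nonneg (sq_nonneg _)]
    exact pow_le_pow_left₀ (norm_nonneg _) (norm_magGrad_le hG.le h.norm_gradient_le z j t) 2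
  have hsqint : ∀ t, Integrable (fun ω =>
      ‖magGrad 1 f T r w₁ (fun n => Z n ω) (fun n => J n ω) t‖ ^ 2) ν := fun t =>
    ((isFinitary_magGrad h.one_le_r t).map fun a => ‖a‖ ^ 2).integrable (hsq t)
      h.chain.measurable h.geom.measurable
  have hV : IsFinitary T fun (z : ℕ → S) j =>
      √(∑ k ∈ Finset.range T, ‖magGrad 1 f T r w₁ z j k‖ ^ 2) :=
    (IsFinitary.sum _ fun k hk => ((isFinitary_magGrad h.one_le_r k).mono
      (Finset.mem_range.1 hk)).map fun a => ‖a‖ ^ 2).map Real.sqrt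
  have hVint := hV.integrable (ν := ν) (C := √(T * ((1 + 2 * T) * G) ^ 2)) (fun z j => by
    rw [abs_of_nonneg (Real.sqrt_nonneg _)]
    refine Real.sqrt_le_sqrt ?_
    simpa using Finset.sum_le_card_nsmul (Finset.range T) _ _
      fun k _ => (le_abs_self _).trans (hsq k z j)) h.chain.measurable h.geom.measurable
  have hsqV : ∀ ω, √(∑ k ∈ Finset.range T,
      ‖magGrad 1 f T r w₁ (fun n => Z n ω) (fun n => J n ω) k‖ ^ 2) ^ 2 =
      ∑ k ∈ Finset.range T, ‖magGrad 1 f T r w₁ (fun n => Z n ω) (fun n => J n ω) k‖ ^ 2 :=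
    fun ω => Real.sq_sqrt (Finset.sum_nonneg fun _ _ => sq_nonneg _)
  have hT0 : (0 : ℝ) < T := by exact_mod_cast hT
  have hsqrt := integral_le_sqrt hVint
    (c := T * (2 * G ^ 2 + Nat.log 2 T * (192 * mixingTime P μ * G ^ 2)))
    (by simpa only [hsqV] using integrable_finsetSum _ fun k _ => hsqint k)
    (by positivity) (by
      simp only [hsqV]
      rw [integral_finsetSum _ fun k _ => hsqint k]
      refine (Finset.sum_le_card_nsmul (Finset.range T) _ _
        fun k _ => h.integral_norm_magGrad_sq_le hT k).trans_eq ?_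
      rw [Finset.card_range, nsmul_eq_mul])
  have hin : ∀ t, Integrable (fun ω => inner ℝ (gradient (objective f μ)
      (magIterate 1 f T r w₁ (fun n => Z n ω) (fun n => J n ω) t))
      (magGrad 1 f T r w₁ (fun n => Z n ω) (fun n => J n ω) t)) ν := fun t =>
    (((h.isFinitary_gradient t).mono t.le_succ).map₂ (isFinitary_magGrad h.one_le_r t)
      (inner ℝ)).integrable (fun z j => h.abs_inner_gradient_le _
        (norm_magGrad_le hG.le h.norm_gradient_le z j t)) h.chain.measurable h.geom.measurable
  rw [← integral_finsetSum _ fun t _ => hin t]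
  refine (integral_mono (integrable_finsetSum _ fun t _ => hin t) (hVint.const_mul (2 * M + L))
    fun ω => hF.sum_inner_le hL hM (fun t => magIterate_succ 1 f T r w₁ _ _ t) T).trans ?_
  rw [integral_const_mul]
  exact mul_le_mul_of_nonneg_left hsqrt (by positivity)

end Setting

/-! ### The convergence rate -/

theorem sqrt_bias_le {τ G : ℝ} (hτ : 0 ≤ τ) (hG : 0 ≤ G) {T : ℕ} (hT : 1 ≤ T) :
    √(16 * τ * G ^ 2 / 2 ^ Nat.log 2 T) ≤ 6 * G * √(τ / T) := by
  have hT0 : (0 : ℝ) < T := by exact_mod_cast hT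
  have hlt : (T : ℝ) ≤ 2 * 2 ^ Nat.log 2 T := by
    have := (Nat.lt_pow_succ_log_self one_lt_two T).le
    rw [pow_succ'] at this
    exact_mod_cast this
  refine Real.sqrt_le_iff.2 ⟨by positivity, ?_⟩
  rw [mul_pow, Real.sq_sqrt (by positivity), div_le_iff₀ (by positivity)]
  have hone : 1 ≤ 2 * 2 ^ Nat.log 2 T / (T : ℝ) := (one_le_div hT0).2 hlt
  calc 16 * τ * G ^ 2 ≤ 18 * τ * G ^ 2 * (2 * 2 ^ Nat.log 2 T / T) := by
        nlinarith [mul_le_mul_of_nonneg_left hone (by positivity : 0 ≤ 18 * τ * G ^ 2),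
          (by positivity : 0 ≤ τ * G ^ 2)]
    _ = (6 * G) ^ 2 * (τ / T) * 2 ^ Nat.log 2 T := by ring

theorem sqrt_second_moment_le {τ G : ℝ} (hτ : 1 ≤ τ) (hG : 0 ≤ G) {T : ℕ} (hT : 1 ≤ T) :
    √(T * (2 * G ^ 2 + Nat.log 2 T * (192 * τ * G ^ 2))) ≤
      17 * G * (1 + Real.log T) * (T * √(τ / T)) := by
  have hT1 : (1 : ℝ) ≤ T := by exact_mod_cast hT
  have hT0 : (0 : ℝ) < T := by linarith
  have hlog0 : 0 ≤ Real.log T := Real.log_nonneg hT1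
  -- `3 / 2 ≥ 1 / log 2`, and below `2 + 3 / 2 * 192 * x ≤ 17 ^ 2 * (1 + x) ^ 2`.
  have hlog : (Nat.log 2 T : ℝ) ≤ 3 / 2 * Real.log T := by
    have h1 : (2 : ℝ) ^ Nat.log 2 T ≤ T := by exact_mod_cast Nat.pow_log_le_self 2 (by omega)
    have h2 := Real.log_le_log (by positivity) h1
    rw [Real.log_pow] at h2
    nlinarith [Real.log_two_gt_d9, (Nat.cast_nonneg (Nat.log 2 T) : (0 : ℝ) ≤ _)]
  refine Real.sqrt_le_iff.2 ⟨by positivity, ?_⟩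
  have hrhs : (17 * G * (1 + Real.log T) * (T * √(τ / T))) ^ 2 =
      T * (289 * (1 + Real.log T) ^ 2 * (τ * G ^ 2)) := by
    rw [mul_pow, mul_pow (T : ℝ), Real.sq_sqrt (by positivity)]
    field_simp
    ring
  rw [hrhs]
  refine mul_le_mul_of_nonneg_left ?_ hT0.le
  have h1 : G ^ 2 ≤ τ * G ^ 2 := le_mul_of_one_le_left (sq_nonneg G) hτ
  calc 2 * G ^ 2 + Nat.log 2 T * (192 * τ * G ^ 2)
      ≤ 2 * (τ * G ^ 2) + 3 / 2 * Real.log T * (192 * (τ * G ^ 2)) := by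
        rw [mul_assoc 192]
        gcongr
    _ ≤ 289 * (1 + Real.log T) ^ 2 * (τ * G ^ 2) := by
        nlinarith [mul_nonneg hlog0 (by positivity : 0 ≤ τ * G ^ 2),
          mul_nonneg (mul_nonneg hlog0 hlog0) (by positivity : 0 ≤ τ * G ^ 2),
          (by positivity : 0 ≤ τ * G ^ 2)]

end MAG

end

theorem mainTheorem3 :
    ∃ (C : ℝ) (k : ℕ), 0 < C ∧
      ∀ (S : Type*) [Fintype S] [DecidableEq S] [MeasurableSpace S] [MeasurableSingletonClass S]
        (P : Matrix S S ℝ) (μ : S → ℝ) (_ : MAG.IsErgodic P) (_ : MAG.IsStationary P μ)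
        (d : ℕ) (f : EuclideanSpace ℝ (Fin d) → S → ℝ) (M L G : ℝ)
        (_ : 0 < M) (_ : 0 ≤ L) (_ : 0 < G)
        (_ : ∀ z, Differentiable ℝ (fun w => f w z))
        (_ : ∀ w z, ‖gradient (fun v => f v z) w‖ ≤ G)
        (_ : MAG.IsSmoothWith L (MAG.objective f μ))
        (_ : ∀ w, |MAG.objective f μ w| ≤ M)
        (Ω : Type*) [MeasurableSpace Ω] (ν : Measure Ω) [IsProbabilityMeasure ν]
        (Z : ℕ → Ω → S) (J : ℕ → Ω → ℕ)
        (_ : MAG.IsMarkovChain ν P Z) (_ : MAG.IsIIDGeomHalf ν J)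
        (_ : IndepFun (fun ω n => Z n ω) (fun ω t => J t ω) ν)
        (T : ℕ) (_ : 1 ≤ T) (r : ℕ → ℕ) (_ : ∀ m, 1 ≤ r m)
        (w₁ : EuclideanSpace ℝ (Fin d)),
        Integrable (fun ω => (1 / (T : ℝ)) * ∑ t ∈ Finset.range T,
          ‖gradient (MAG.objective f μ)
            (MAG.magIterate 1 f T r w₁ (fun n => Z n ω) (fun t => J t ω) t)‖ ^ 2) ν ∧
        ∫ ω, (1 / (T : ℝ)) * ∑ t ∈ Finset.range T,
          ‖gradient (MAG.objective f μ)
            (MAG.magIterate 1 f T r w₁ (fun n => Z n ω) (fun t => J t ω) t)‖ ^ 2 ∂ν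
        ≤ C * (1 + Real.log T) ^ k *
            ((M + L + G) * G * √((MAG.mixingTime P μ : ℝ) / T)) := by
  -- `34 = 2 * 17`: the constant of the second moment bound times the `2` of `2 * M + L`.
  refine ⟨34, 1, by norm_num, ?_⟩
  intro S _ _ _ _ P μ hP hμ d f M L G hM0 hL hG hf hfG hF hM Ω _ ν _ Z J hZ hJ hind T hT r hr w₁
  have h : MAG.Setting ν P μ f G Z J r := ⟨hP, hμ, hG, hf, hfG, hZ, hJ, hind, hr⟩
  have hint := fun t => h.integrable_norm_gradient_sq (α := 1) (T := T) (w₁ := w₁) t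
  refine ⟨(integrable_finsetSum _ fun t _ => hint t).const_mul _, ?_⟩
  have hT1 : (1 : ℝ) ≤ T := by exact_mod_cast hT
  have hT0 : (0 : ℝ) < T := by linarith
  have hτ : (1 : ℝ) ≤ MAG.mixingTime P μ := by exact_mod_cast h.mixingTime_spec.1
  have hlog0 : 0 ≤ Real.log T := Real.log_nonneg hT1
  rw [integral_const_mul, integral_finsetSum _ fun t _ => hint t, one_div, inv_mul_le_iff₀ hT0]
  have hsum := Finset.sum_le_sum fun t (_ : t ∈ Finset.range T) =>
    h.integral_norm_gradient_sq_le (α := 1) (w₁ := w₁) hT t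
  rw [Finset.sum_add_distrib, Finset.sum_const, Finset.card_range, nsmul_eq_mul] at hsum
  have hreg := h.sum_integral_inner_le (w₁ := w₁) hL hM0.le hF hM hT
  have hb := MAG.sqrt_bias_le (zero_le_one.trans hτ) hG.le hT
  have hv := MAG.sqrt_second_moment_le hτ hG.le hT
  set s := √((MAG.mixingTime P μ : ℝ) / T)
  have hs : 0 ≤ s := Real.sqrt_nonneg _
  calc _ ≤ _ := hsum
    _ ≤ (2 * M + L) * (17 * G * (1 + Real.log T) * (T * s)) + T * (G * (6 * G * s)) := by
        gcongr
        exact hreg.trans (by gcongr)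
    _ ≤ (2 * M + L) * (17 * G * (1 + Real.log T) * (T * s)) +
          (17 * L + 34 * G) * (G * (1 + Real.log T) * (T * s)) := by
        have h1 : 0 ≤ G * (T * s) := by positivity
        have h2 : G * (T * s) ≤ G * (1 + Real.log T) * (T * s) := by
          nlinarith [mul_nonneg hlog0 h1]
        nlinarith [mul_le_mul_of_nonneg_left h2 hG.le, mul_nonneg hL (h1.trans h2),
          mul_nonneg hG.le h1]
    _ = T * (34 * (1 + Real.log T) ^ 1 * ((M + L + G) * G * s)) := by ring
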